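/- **Robust sparse PCA.** Notation. For $A\in\mathbb{R}^{d\times d}$ and $Q\subseteq[d]\times[d]$ let $A_Q$ agree with $A$ on $Q$ and be zero elsewhere, and let $\|A\|_{F,m}=\max_{|Q|\le m}\|A_Q\|_F$ be the largest Frobenius norm of $m$ entries of $A$. For $n\ge 1$ let $\Delta_{n,\epsilon}=\{w\in\mathbb{R}^n:\ \sum_i w_i=1,\ 0\le w_i\le \frac1{(1-\epsilon)n}\ \forall i\}$. Samples $G^\star=(X_i)_{i=1}^n$ in $\mathbb{R}^d$ are *$(k,\epsilon,\delta)$-stable* with respect to a centered distribution with covariance $I+\rho vv^\top$ if $$\Big\|\sum_i w_iX_iX_i^\top-(I+\rho vv^\top)\Big\|_{F,2k^2}\le\delta\qquad\text{for all } w\in\Delta_{n,2\epsilon}.$$ A family $S$ of $n$ points of $\mathbb{R}^d$ is an *$\epsilon$-corrupted version* of $G^\star$ if it is obtained from $G^\star$ by replacing at most $\epsilon n$ of the points by arbitrary points (and possibly reordering). A unit vector is a vector of Euclidean norm $1$; it is $k$-sparse if it has at most $k$ nonzero coordinates. **Theorem.** There are absolute constants $\epsilon_0\in(0,\frac12)$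 and $C$, and a single algorithm which takes as input only $S$, $k$ and $\epsilon$, performs on every input a number of elementary steps that is at most a fixed polynomial in $n$ and $d$, and has the following guarantee. Let $n\ge1$, $0<\rho\le 1$, $0<\epsilon<\epsilon_0$ and $\delta\in\mathbb{R}$, let $v\in\mathbb{R}^d$ be a $k$-sparse unit vector, let $G^\star$ be a family of $n$ samples that is $(k,\epsilon,\delta)$-stable with respect to a centered distribution with covariance $I+\rho vv^\top$, and let $S$ be an $\epsilon$-corrupted version of $G^\star$. Then on input $(S,k,\epsilon)$ the algorithm returns a vector $u\in\mathbb{R}^d$ with $$\|uu^\top-vv^\top\|_F\le C\sqrt{\delta/\rho}.$$ (Elementary steps are those of a real RAM: exact arithmetic $+,-,\times,/,\sqrt{\cdot}$ and comparison of reals, addition, truncated subtraction and comparison of integer counters, conversion of a counter to a real, branching, pointer operations on lists, and loop control, each at unit cost. The algorithm is one fixed program for all $n,d,k$.) -/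

import Mathlib

open scoped Matrix.Norms.Frobenius

namespace RobustSparsePCA

/-! ### Machine model: unit-cost programs over the real numbers

Programs of a small first-order language (in the style of a real RAM with linked lists).  Every
primitive is an operation that a real RAM performs in constant time: exact arithmetic and
comparison of real numbers, arithmetic of counters, pairing, projections, and
pointer operations on (immutable, shared) linked lists.  There is no rounding of reals to
integers, and all loops are bounded, so every program terminates on every input. -/

/-- Data types of the language. -/
inductive Ty : Type
  | bool : Ty
  | nat : Ty
  | real : Ty
  | prod : Ty → Ty → Ty
  | list : Ty → Ty

/-- The values of a data type. -/
@[reducible] def Ty.Val : Ty → Type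
  | .bool => Bool
  | .nat => ℕ
  | .real => ℝ
  | .prod a b => a.Val × b.Val
  | .list a => List a.Val

/-- `Prog a b`: programs with input type `a` and output type `b`. -/
inductive Prog : Ty → Ty → Type
  /- plumbing -/
  | id {a : Ty} : Prog a a
  | comp {a b c : Ty} (g : Prog b c) (f : Prog a b) : Prog a c
  | pair {a b c : Ty} (f : Prog a b) (g : Prog a c) : Prog a (.prod b c)
  | fst {a b : Ty} : Prog (.prod a b) a
  | snd {a b : Ty} : Prog (.prod a b) b
  /- branching -/
  | cond {a b : Ty} (test : Prog a .bool) (yes no : Prog a b) : Prog a b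
  /- counters -/
  | natConst {a : Ty} (m : ℕ) : Prog a .nat
  | natAdd : Prog (.prod .nat .nat) .nat
  | natSub : Prog (.prod .nat .nat) .nat
  | natLe : Prog (.prod .nat .nat) .bool
  /- reals -/
  | realConst {a : Ty} (q : ℚ) : Prog a .real
  | natToReal : Prog .nat .real
  | realAdd : Prog (.prod .real .real) .real
  | realSub : Prog (.prod .real .real) .real
  | realMul : Prog (.prod .real .real) .real
  | realDiv : Prog (.prod .real .real) .real
  | realSqrt : Prog .real .real
  | realLe : Prog (.prod .real .real) .bool
  /- linked lists -/
  | nil {a b : Ty} : Prog a (.list b)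
  | cons {a : Ty} : Prog (.prod a (.list a)) (.list a)
  | uncons {a b c : Ty} (onNil : Prog c b) (onCons : Prog (.prod c (.prod a (.list a))) b) :
      Prog (.prod c (.list a)) b
  /- bounded loops: repeat `body` a given number of times; run `body` once per list entry -/
  | iter {a : Ty} (body : Prog a a) : Prog (.prod .nat a) a
  | foldl {a b : Ty} (body : Prog (.prod b a) b) : Prog (.prod b (.list a)) b

open Classical in
/-- The output of a program on a given input. -/
noncomputable def Prog.run : {a b : Ty} → Prog a b → a.Val → b.Val
  | _, _, .id, x => x
  | _, _, .comp g f, x => g.run (f.run x)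
  | _, _, .pair f g, x => (f.run x, g.run x)
  | _, _, .fst, x => x.1
  | _, _, .snd, x => x.2
  | _, _, .cond test yes no, x => if test.run x = true then yes.run x else no.run x
  | _, _, .natConst m, _ => m
  | _, _, .natAdd, x => x.1 + x.2
  | _, _, .natSub, x => x.1 - x.2
  | _, _, .natLe, x => decide (x.1 ≤ x.2)
  | _, _, .realConst q, _ => (q : ℝ)
  | _, _, .natToReal, m => (m : ℝ)
  | _, _, .realAdd, x => x.1 + x.2
  | _, _, .realSub, x => x.1 - x.2
  | _, _, .realMul, x => x.1 * x.2
  | _, _, .realDiv, x => x.1 / x.2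
  | _, _, .realSqrt, x => Real.sqrt x
  | _, _, .realLe, x => decide (x.1 ≤ x.2)
  | _, _, .nil, _ => []
  | _, _, .cons, x => x.1 :: x.2
  | _, _, .uncons onNil onCons, x =>
      match x.2 with
      | [] => onNil.run x.1
      | y :: l => onCons.run (x.1, (y, l))
  | _, _, .iter body, x => (fun s => body.run s)^[x.1] x.2
  | _, _, .foldl body, x => x.2.foldl (fun s y => body.run (s, y)) x.1

/-- Total cost of a loop over a list: `next` updates the state, `cost` is the cost of the body. -/
def foldCost {σ α : Type} (next : σ → α → σ) (cost : σ → α → ℕ) : σ → List α → ℕ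
  | _, [] => 0
  | s, y :: l => (cost s y + 1) + foldCost next cost (next s y) l

/-- The number of elementary steps of a program on a given input. -/
noncomputable def Prog.steps : {a b : Ty} → Prog a b → a.Val → ℕ
  | _, _, .comp g f, x => f.steps x + g.steps (f.run x) + 1
  | _, _, .pair f g, x => f.steps x + g.steps x + 1
  | _, _, .cond test yes no, x =>
      test.steps x + (if test.run x = true then yes.steps x else no.steps x) + 1
  | _, _, .uncons onNil onCons, x =>
      match x.2 with
      | [] => onNil.steps x.1 + 1
      | y :: l => onCons.steps (x.1, (y, l)) + 1
  | _, _, .iter body, x =>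
      (∑ t ∈ Finset.range x.1, (body.steps ((fun s => body.run s)^[t] x.2) + 1)) + 1
  | _, _, .foldl body, x =>
      foldCost (fun s y => body.run (s, y)) (fun s y => body.steps (s, y)) x.1 x.2 + 1
  | _, _, _, _ => 1

/-! ### Input and output of the estimation algorithm -/

/-- Input: the list of samples (each a list of coordinates), the sparsity `k`, and `ε`. -/
abbrev inputTy : Ty := .prod (.list (.list .real)) (.prod .nat .real)

/-- Output: a vector, as the list of its coordinates. -/
abbrev outputTy : Ty := .list .real

/-- The input `(S, k, ε)` as data of the language. -/
def encodeInput {n d : ℕ} (S : Fin n → Fin d → ℝ) (k : ℕ) (ε : ℝ) : inputTy.Val :=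
  (List.ofFn fun i => List.ofFn (S i), (k, ε))

/-! ### Stability and corruption -/

/-- The matrix `A_Q`: equal to `A` on the set of entries `Q`, and zero elsewhere. -/
def restrictEntries {d : ℕ} (Q : Finset (Fin d × Fin d)) (A : Matrix (Fin d) (Fin d) ℝ) :
    Matrix (Fin d) (Fin d) ℝ :=
  Matrix.of fun i j => if (i, j) ∈ Q then A i j else 0

/-- The maximum Frobenius norm of (at most) `m` entries of `A`. If `m` is at most the number
of entries this is the maximum over sets of exactly `m` entries, otherwise it is `‖A‖_F`. -/
noncomputable def sparseFrobNorm {d : ℕ} (m : ℕ) (A : Matrix (Fin d) (Fin d) ℝ) : ℝ :=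
  (Finset.univ.filter fun Q : Finset (Fin d × Fin d) => Q.card ≤ m).sup' ⟨∅, by simp⟩
    fun Q => ‖restrictEntries Q A‖

/-- `Δ_{n,ε}`: the weight vectors on `n` samples with entries in `[0, 1/((1-ε)n)]`. -/
def weights (n : ℕ) (ε : ℝ) : Set (Fin n → ℝ) :=
  {w | (∀ i, 0 ≤ w i ∧ w i ≤ 1 / ((1 - ε) * n)) ∧ ∑ i, w i = 1}

/-- The weighted second-moment matrix `M_w = ∑ w_i X_i X_iᵀ`. -/
def secondMoment {n d : ℕ} (X : Fin n → Fin d → ℝ) (w : Fin n → ℝ) :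
    Matrix (Fin d) (Fin d) ℝ :=
  ∑ i, w i • Matrix.vecMulVec (X i) (X i)

/-- The spiked covariance `I + ρ v vᵀ`. -/
def spikedCov {d : ℕ} (ρ : ℝ) (v : Fin d → ℝ) : Matrix (Fin d) (Fin d) ℝ :=
  1 + ρ • Matrix.vecMulVec v v

/-- `(k, ε, δ)`-stability of the samples `G` with respect to a centered distribution with
covariance `I + ρ v vᵀ`. -/
def IsStable {n d : ℕ} (k : ℕ) (ε δ ρ : ℝ) (v : Fin d → ℝ) (G : Fin n → Fin d → ℝ) : Prop :=
  ∀ w ∈ weights n (2 * ε), sparseFrobNorm (2 * k ^ 2) (secondMoment G w - spikedCov ρ v) ≤ δ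

/-- `S` is an `ε`-corrupted version of `G`: at most `ε n` of the points have been
replaced by arbitrary points, and the points may have been reordered. -/
def IsCorruption {n d : ℕ} (ε : ℝ) (G S : Fin n → Fin d → ℝ) : Prop :=
  ∃ σ : Equiv.Perm (Fin n), ({i | S i ≠ G (σ i)}.ncard : ℝ) ≤ ε * n

/-- `v` is a unit vector (in the Euclidean norm) with at most `k` nonzero entries. -/
def IsSparseUnit {d : ℕ} (k : ℕ) (v : Fin d → ℝ) : Prop :=
  ∑ j, v j ^ 2 = 1 ∧ {j | v j ≠ 0}.ncard ≤ k

end RobustSparsePCA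

/-! The algorithm is a filter. Each sample carries a weight, initially 1. From the weighted second
moment minus the identity, `centeredMoment`, keep the `2k²` largest entries, giving `B`; score each
sample `x` by `xᵀBx`; shrink the weights of samples scoring above the upper `2ε`-quantile, in
proportion to the excess, so that one weight dies. After `n` rounds take the `B` of least Frobenius
norm among those whose weights have mass at least `(1-2ε)n`, and return its best normalized column.
Neither `ρ` nor `δ` is known, so the least norm replaces a stopping rule.

Upper bound on `B`. By duality, stability bounds every weighted mean of a quadratic form with at
most `2k²` nonzero entries (`IsStable.meanBound`). If `‖B‖_F > ρ + 14δ`, the mean score is too large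
for the good samples to explain, and more excess lies on corrupted samples than on good ones
(`sum_excess_lt`). Such rounds remove at least as much bad weight as good, so the mass stays at
least `(1-2ε)n`. This cannot persist until every weight is gone, so some round has `‖B‖_F ≤ ρ + 14δ`
(`robustMatrix_spec`).

Lower bound. Corrupted samples add squares to the form at `v`, so every admissible weighting
satisfies `vᵀAv ≥ ρ - 4ε - 10δ` (`le_quadForm_centeredMoment`). For `d ≥ 2` stability itself forces
`ε ≤ 60δ` (`IsStable.eps_le`), so all losses are `O(δ)`.

Conclusion. Small norm and large correlation with the spike give `‖B - ρvvᵀ‖_F² = O(ρδ)`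
(`sqNorm_truncate_sub_le`). A matrix this close to a rank-one spike has a column nearly parallel to
`v`, and the column with the largest squared quadratic form is as good up to constants
(`sqNorm_principalDirection_sub_le`). Dividing by `ρ²` gives squared error `O(δ/ρ)`.

Running time is handled by a calculus of closure rules for `PolyTime`: each definition of the
algorithm is transcribed rule by rule, which yields the program and its step bound together. -/

namespace RobustSparsePCA

/-! ### Polynomially bounded functions -/

/-- `g` is bounded by a fixed polynomial in the size `N`. -/
def IsPoly {X : Type} (N g : X → ℕ) : Prop := ∃ c : ℕ, ∀ x, g x ≤ c * (N x + 1) ^ c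

namespace IsPoly

variable {X : Type} {N g h : X → ℕ}

theorem mono (hh : IsPoly N h) (hgh : ∀ x, g x ≤ h x) : IsPoly N g :=
  hh.imp fun _ hc x => (hgh x).trans (hc x)

theorem const (m : ℕ) : IsPoly N fun _ => m :=
  ⟨m, fun x => Nat.le_mul_of_pos_right _ (by positivity)⟩

theorem size : IsPoly N N := ⟨1, fun x => by simp⟩

theorem add (hg : IsPoly N g) (hh : IsPoly N h) : IsPoly N fun x => g x + h x := by
  obtain ⟨a, ha⟩ := hg
  obtain ⟨b, hb⟩ := hh
  refine ⟨a + b, fun x => ?_⟩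
  have h1 : (N x + 1) ^ a ≤ (N x + 1) ^ (a + b) := Nat.pow_le_pow_right (by omega) (by omega)
  have h2 : (N x + 1) ^ b ≤ (N x + 1) ^ (a + b) := Nat.pow_le_pow_right (by omega) (by omega)
  calc g x + h x ≤ a * (N x + 1) ^ a + b * (N x + 1) ^ b := add_le_add (ha x) (hb x)
    _ ≤ a * (N x + 1) ^ (a + b) + b * (N x + 1) ^ (a + b) := by gcongr
    _ = _ := by ring

theorem mul (hg : IsPoly N g) (hh : IsPoly N h) : IsPoly N fun x => g x * h x := by
  obtain ⟨a, ha⟩ := hg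
  obtain ⟨b, hb⟩ := hh
  -- One number serves as both coefficient and exponent, so it must dominate `a * b` and `a + b`.
  refine ⟨a * b + (a + b), fun x => ?_⟩
  calc g x * h x ≤ (a * (N x + 1) ^ a) * (b * (N x + 1) ^ b) := Nat.mul_le_mul (ha x) (hb x)
    _ = (a * b) * (N x + 1) ^ (a + b) := by ring
    _ ≤ (a * b + (a + b)) * (N x + 1) ^ (a * b + (a + b)) :=
      Nat.mul_le_mul (by omega) (Nat.pow_le_pow_right (by omega) (by omega))

theorem reindex {Y : Type} {N' : Y → ℕ} (hg : IsPoly N g) (π : Y → X)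
    (hN : ∀ y, N (π y) ≤ N' y) : IsPoly N' fun y => g (π y) := by
  obtain ⟨a, ha⟩ := hg
  exact ⟨a, fun y => (ha _).trans (by gcongr; exact hN y)⟩

end IsPoly

/-! ### Functions computed in polynomial time -/

/-- The function `f` of the environment `x` is computed by some program from the data `ctx x`, in
a number of steps polynomial in `N x`. -/
def PolyTime {X : Type} (N : X → ℕ) {a b : Ty} (ctx : X → a.Val) (f : X → b.Val) : Prop :=
  ∃ p : Prog a b, (∀ x, p.run (ctx x) = f x) ∧ IsPoly N fun x => p.steps (ctx x)

/-- The predicate `P` on environments is decided by some program from the data `ctx x`, in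
a number of steps polynomial in `N x`. -/
def PolyTest {X : Type} (N : X → ℕ) {a : Ty} (ctx : X → a.Val) (P : X → Prop) : Prop :=
  ∃ p : Prog a .bool, (∀ x, p.run (ctx x) = true ↔ P x) ∧ IsPoly N fun x => p.steps (ctx x)

/-- Coordinates of a vector, as data of the language. -/
abbrev encVec {m : ℕ} (v : Fin m → ℝ) : (Ty.list .real).Val := List.ofFn v

/-- Rows of a matrix, as data of the language. -/
abbrev encMat {m d : ℕ} (A : Fin m → Fin d → ℝ) : (Ty.list (.list .real)).Val :=
  List.ofFn fun i => List.ofFn (A i)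

namespace PolyTime

variable {X : Type} {N : X → ℕ} {a b c s : Ty} {ctx : X → a.Val}

theorem congr {f g : X → b.Val} (hf : PolyTime N ctx f) (h : ∀ x, f x = g x) :
    PolyTime N ctx g := by
  rwa [← funext h]

theorem id : PolyTime N ctx ctx := ⟨.id, fun _ => rfl, IsPoly.const 1⟩

theorem comp {g : X → b.Val} {f : X → c.Val} (hf : PolyTime N g f) (hg : PolyTime N ctx g) :
    PolyTime N ctx f := by
  obtain ⟨p, hp, hp'⟩ := hf
  obtain ⟨q, hq, hq'⟩ := hg
  refine ⟨.comp p q, fun x => ?_, ?_⟩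
  · simp only [Prog.run, hq, hp]
  · simp only [Prog.steps, hq]
    exact (hq'.add hp').add (IsPoly.const 1)

theorem pair {f : X → b.Val} {g : X → c.Val} (hf : PolyTime N ctx f) (hg : PolyTime N ctx g) :
    PolyTime (b := .prod b c) N ctx fun x => (f x, g x) := by
  obtain ⟨p, hp, hp'⟩ := hf
  obtain ⟨q, hq, hq'⟩ := hg
  refine ⟨.pair p q, fun x => ?_, ?_⟩
  · simp only [Prog.run, hq, hp]
  · simp only [Prog.steps]
    exact (hp'.add hq').add (IsPoly.const 1)

theorem fst {f : X → b.Val} {g : X → c.Val} :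
    PolyTime (a := .prod b c) N (fun x => (f x, g x)) f :=
  ⟨.fst, fun _ => rfl, IsPoly.const 1⟩

theorem snd {f : X → b.Val} {g : X → c.Val} :
    PolyTime (a := .prod b c) N (fun x => (f x, g x)) g :=
  ⟨.snd, fun _ => rfl, IsPoly.const 1⟩

/-- Change of environment. -/
theorem reindex {Y : Type} {N' : Y → ℕ} {f : X → b.Val} (hf : PolyTime N ctx f) (π : Y → X)
    (hN : ∀ y, N (π y) ≤ N' y) : PolyTime N' (fun y => ctx (π y)) fun y => f (π y) := by
  obtain ⟨p, hp, hp'⟩ := hf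
  exact ⟨p, fun y => hp _, hp'.reindex π hN⟩

/-- Weakening: a variable is added to the environment. -/
theorem wk {Y : X → Type} {f : X → b.Val} (hf : PolyTime N ctx f)
    {y : (Σ x, Y x) → c.Val} :
    PolyTime (X := Σ x, Y x) (a := .prod a c) (fun p => N p.1) (fun p => (ctx p.1, y p))
      fun p => f p.1 :=
  (hf.reindex (Y := Σ x, Y x) (N' := fun p => N p.1) Sigma.fst fun _ => le_rfl).comp fst

theorem wk₂ {Y : X → Type} {Z : (Σ x, Y x) → Type} {f : X → b.Val} {b₁ b₂ : Ty}
    (hf : PolyTime N ctx f) {y : (Σ p, Z p) → b₁.Val} {z : (Σ p, Z p) → b₂.Val} :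
    PolyTime (X := Σ p, Z p) (a := .prod (.prod a b₁) b₂) (fun p => N p.1.1)
      (fun p => ((ctx p.1.1, y p), z p)) fun p => f p.1.1 :=
  (hf.reindex (Y := Σ p, Z p) (N' := fun p => N p.1.1) (fun p => p.1.1)
    fun _ => le_rfl).comp (fst.comp fst)

theorem wk₃ {Y : X → Type} {Z : (Σ x, Y x) → Type} {W : (Σ p, Z p) → Type} {f : X → b.Val}
    {b₁ b₂ b₃ : Ty} (hf : PolyTime N ctx f) {y : (Σ p, W p) → b₁.Val} {z : (Σ p, W p) → b₂.Val}
    {w : (Σ p, W p) → b₃.Val} :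
    PolyTime (X := Σ p, W p) (a := .prod (.prod (.prod a b₁) b₂) b₃) (fun p => N p.1.1.1)
      (fun p => (((ctx p.1.1.1, y p), z p), w p)) fun p => f p.1.1.1 :=
  (hf.reindex (Y := Σ p, W p) (N' := fun p => N p.1.1.1) (fun p => p.1.1.1)
    fun _ => le_rfl).comp (fst.comp (fst.comp fst))

theorem wk₄ {Y : X → Type} {Z : (Σ x, Y x) → Type} {W : (Σ p, Z p) → Type}
    {V : (Σ p, W p) → Type} {f : X → b.Val}
    {b₁ b₂ b₃ b₄ : Ty} (hf : PolyTime N ctx f) {y : (Σ p, V p) → b₁.Val}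
    {z : (Σ p, V p) → b₂.Val} {w : (Σ p, V p) → b₃.Val} {v : (Σ p, V p) → b₄.Val} :
    PolyTime (X := Σ p, V p) (a := .prod (.prod (.prod (.prod a b₁) b₂) b₃) b₄)
      (fun p => N p.1.1.1.1) (fun p => ((((ctx p.1.1.1.1, y p), z p), w p), v p))
      fun p => f p.1.1.1.1 :=
  (hf.reindex (Y := Σ p, V p) (N' := fun p => N p.1.1.1.1) (fun p => p.1.1.1.1)
    fun _ => le_rfl).comp (fst.comp (fst.comp (fst.comp fst)))

theorem natConst (m : ℕ) : PolyTime (b := .nat) N ctx fun _ => m :=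
  ⟨.natConst m, fun _ => rfl, IsPoly.const 1⟩

theorem realConst (q : ℚ) : PolyTime (b := .real) N ctx fun _ => (q : ℝ) :=
  ⟨.realConst q, fun _ => rfl, IsPoly.const 1⟩

theorem nil : PolyTime (b := .list b) N ctx fun _ => [] :=
  ⟨.nil, fun _ => rfl, IsPoly.const 1⟩

/-- Application of a primitive. -/
theorem prim {f : X → b.Val} (hf : PolyTime N ctx f) (p : Prog b c)
    (hp : ∀ y, p.steps y = 1) : PolyTime N ctx fun x => p.run (f x) :=
  comp ⟨p, fun _ => rfl, (IsPoly.const 1).mono fun _ => (hp _).le⟩ hf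

theorem natAdd {f g : X → ℕ} (hf : PolyTime (b := .nat) N ctx f)
    (hg : PolyTime (b := .nat) N ctx g) : PolyTime (b := .nat) N ctx fun x => f x + g x :=
  (hf.pair hg).prim .natAdd fun _ => rfl

theorem natSub {f g : X → ℕ} (hf : PolyTime (b := .nat) N ctx f)
    (hg : PolyTime (b := .nat) N ctx g) : PolyTime (b := .nat) N ctx fun x => f x - g x :=
  (hf.pair hg).prim .natSub fun _ => rfl

theorem natCast {f : X → ℕ} (hf : PolyTime (b := .nat) N ctx f) :
    PolyTime (b := .real) N ctx fun x => (f x : ℝ) :=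
  hf.prim .natToReal fun _ => rfl

theorem add {f g : X → ℝ} (hf : PolyTime (b := .real) N ctx f)
    (hg : PolyTime (b := .real) N ctx g) : PolyTime (b := .real) N ctx fun x => f x + g x :=
  (hf.pair hg).prim .realAdd fun _ => rfl

theorem sub {f g : X → ℝ} (hf : PolyTime (b := .real) N ctx f)
    (hg : PolyTime (b := .real) N ctx g) : PolyTime (b := .real) N ctx fun x => f x - g x :=
  (hf.pair hg).prim .realSub fun _ => rfl

theorem mul {f g : X → ℝ} (hf : PolyTime (b := .real) N ctx f)
    (hg : PolyTime (b := .real) N ctx g) : PolyTime (b := .real) N ctx fun x => f x * g x :=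
  (hf.pair hg).prim .realMul fun _ => rfl

theorem div {f g : X → ℝ} (hf : PolyTime (b := .real) N ctx f)
    (hg : PolyTime (b := .real) N ctx g) : PolyTime (b := .real) N ctx fun x => f x / g x :=
  (hf.pair hg).prim .realDiv fun _ => rfl

theorem sqrt {f : X → ℝ} (hf : PolyTime (b := .real) N ctx f) :
    PolyTime (b := .real) N ctx fun x => Real.sqrt (f x) :=
  hf.prim .realSqrt fun _ => rfl

theorem sq {f : X → ℝ} (hf : PolyTime (b := .real) N ctx f) :
    PolyTime (b := .real) N ctx fun x => f x ^ 2 :=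
  (hf.mul hf).congr fun _ => (pow_two _).symm

theorem cons {f : X → b.Val} {g : X → List b.Val} (hf : PolyTime N ctx f)
    (hg : PolyTime (b := .list b) N ctx g) : PolyTime (b := .list b) N ctx fun x => f x :: g x :=
  (hf.pair hg).prim .cons fun _ => rfl

theorem natLe {f g : X → ℕ} (hf : PolyTime (b := .nat) N ctx f)
    (hg : PolyTime (b := .nat) N ctx g) : PolyTest N ctx fun x => f x ≤ g x := by
  obtain ⟨p, hp, hp'⟩ := (hf.pair hg).prim .natLe fun _ => rfl
  exact ⟨p, fun x => by rw [hp]; simp [Prog.run], hp'⟩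

theorem realLe {f g : X → ℝ} (hf : PolyTime (b := .real) N ctx f)
    (hg : PolyTime (b := .real) N ctx g) : PolyTest N ctx fun x => f x ≤ g x := by
  obtain ⟨p, hp, hp'⟩ := (hf.pair hg).prim .realLe fun _ => rfl
  exact ⟨p, fun x => by rw [hp]; simp [Prog.run], hp'⟩

theorem ite {P : X → Prop} [∀ x, Decidable (P x)] {f g : X → b.Val} (hP : PolyTest N ctx P)
    (hf : PolyTime N ctx f) (hg : PolyTime N ctx g) :
    PolyTime N ctx fun x => if P x then f x else g x := by
  obtain ⟨t, ht, ht'⟩ := hP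
  obtain ⟨p, hp, hp'⟩ := hf
  obtain ⟨q, hq, hq'⟩ := hg
  refine ⟨.cond t p q, fun x => ?_, ?_⟩
  · simp only [Prog.run, hq, hp, ht]
  · refine ((ht'.add (hp'.add hq')).add (IsPoly.const 1)).mono fun x => ?_
    simp only [Prog.steps]
    split_ifs <;> omega

end PolyTime

namespace PolyTest

variable {X : Type} {N : X → ℕ} {a : Ty} {ctx : X → a.Val} {P Q : X → Prop}

theorem congr (hP : PolyTest N ctx P) (h : ∀ x, P x ↔ Q x) : PolyTest N ctx Q := by
  rwa [← funext fun x => propext (h x)]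

/-- The language has no Boolean connectives; truth values are coded by the counters 1 and 0 and
compared. -/
theorem not (hP : PolyTest N ctx P) : PolyTest N ctx fun x => ¬ P x := by
  classical
  obtain ⟨p, hp, hp'⟩ := PolyTime.ite hP (PolyTime.natConst 1) (PolyTime.natConst 0)
  refine (PolyTime.natLe ⟨p, hp, hp'⟩ (PolyTime.natConst 0)).congr fun x => ?_
  by_cases h : P x <;> simp [h]

theorem and (hP : PolyTest N ctx P) (hQ : PolyTest N ctx Q) :
    PolyTest N ctx fun x => P x ∧ Q x := by
  classical
  refine (PolyTime.natLe (PolyTime.natConst 1) (PolyTime.ite hP (PolyTime.ite hQ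
    (PolyTime.natConst 1) (PolyTime.natConst 0)) (PolyTime.natConst 0))).congr fun x => ?_
  by_cases h : P x <;> by_cases h' : Q x <;> simp [h, h']

theorem or (hP : PolyTest N ctx P) (hQ : PolyTest N ctx Q) :
    PolyTest N ctx fun x => P x ∨ Q x :=
  (hP.not.and hQ.not).not.congr fun x => by tauto

end PolyTest

/-! ### Loops -/

namespace PolyTime

variable {X : Type} {N : X → ℕ} {a b c s : Ty} {ctx : X → a.Val}

/-- `Prog.iter` shows its body neither the round number nor the ambient data, so both travel inside
the state. -/
theorem run_iterate_loop (p : Prog (.prod a (.prod .nat s)) s) {σ : Type} (enc : σ → s.Val)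
    (y : a.Val) (m : ℕ) (step : Fin m → σ → σ) (init : σ)
    (hp : ∀ (j : Fin m) t, p.run (y, ((j : ℕ), enc t)) = enc (step j t)) (k : ℕ) (hk : k ≤ m) :
    (fun z => (Prog.pair .fst (.pair (.comp .natAdd (.pair (.comp .fst .snd) (.natConst 1)))
        p)).run z)^[k] (y, (0, enc init)) =
      (y, (k, enc (Fin.foldl k (fun t j => step (Fin.castLE hk j) t) init))) := by
  induction k with
  | zero => simp
  | succ k ih =>
    rw [Function.iterate_succ_apply', ih (by omega), Fin.foldl_succ_last]
    have := hp ⟨k, hk⟩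
    simp only [Prog.run, Prod.mk.injEq, true_and]
    exact this _

/-- The body must obey one bound in `N x` for every state in `σ x`. With state types such as `Fin (m
x) → ℝ` list lengths cannot grow, so the total cost is just the number of rounds times that bound.
-/
theorem loop {σ : X → Type} (enc : ∀ x, σ x → s.Val) {m : X → ℕ}
    (step : ∀ x, Fin (m x) → σ x → σ x) (init : ∀ x, σ x)
    (hm : PolyTime (b := .nat) N ctx m) (hmN : ∀ x, m x ≤ N x)
    (hinit : PolyTime N ctx fun x => enc x (init x))
    (hstep : PolyTime (X := Σ x, Fin (m x) × σ x) (a := .prod a (.prod .nat s))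
      (fun p => N p.1) (fun p => (ctx p.1, ((p.2.1 : ℕ), enc p.1 p.2.2)))
      fun p => enc p.1 (step p.1 p.2.1 p.2.2)) :
    PolyTime N ctx fun x => enc x (Fin.foldl (m x) (fun t j => step x j t) (init x)) := by
  obtain ⟨p, hp, hp'⟩ := hstep
  let body : Prog (.prod a (.prod .nat s)) (.prod a (.prod .nat s)) :=
    Prog.pair .fst (.pair (.comp .natAdd (.pair (.comp .fst .snd) (.natConst 1))) p)
  have hrun := fun x => run_iterate_loop p (enc x) (ctx x) (m x) (step x) (init x)
    fun (j : Fin (m x)) t => hp ⟨x, j, t⟩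
  have hloop : PolyTime (a := .prod .nat (.prod a (.prod .nat s))) (b := .prod a (.prod .nat s))
      N (fun x => (m x, (ctx x, (0, enc x (init x)))))
      fun x => (ctx x, (m x, enc x (Fin.foldl (m x) (fun t j => step x j t) (init x)))) := by
    refine ⟨.iter body, fun x => hrun x (m x) le_rfl, ?_⟩
    obtain ⟨e, he⟩ := hp'
    refine ((IsPoly.size.mul ((IsPoly.const (N := N) 20).add ⟨e, fun x => le_rfl⟩)).add
      (IsPoly.const 1)).mono fun x => ?_
    simp only [Prog.steps, Nat.add_le_add_iff_right]
    refine (Finset.sum_le_card_nsmul _ _ (20 + e * (N x + 1) ^ e) fun k hk => ?_).trans ?_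
    · have hk := Finset.mem_range.1 hk
      rw [hrun x k hk.le]
      have := he ⟨x, ⟨k, hk⟩, Fin.foldl k (fun t j => step x (Fin.castLE hk.le j) t) (init x)⟩
      simp only [body, Prog.steps] at this ⊢
      generalize e * (N x + 1) ^ e = K at this ⊢
      omega
    · simp only [Finset.card_range, smul_eq_mul]
      gcongr
      exact hmN x
  have h0 : PolyTime (b := .prod a (.prod .nat s)) N ctx _ :=
    hloop.comp (hm.pair (id.pair ((natConst 0).pair hinit)))
  exact snd.comp (snd.comp h0)

/-- The innermost variable of the environment. -/
theorem var₀ {e : X → a.Val} {f : X → b.Val} :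
    PolyTime (a := .prod a b) N (fun x => (e x, f x)) f := snd

/-- The second innermost variable of the environment. -/
theorem var₁ {e : X → a.Val} {f : X → b.Val} {g : X → c.Val} :
    PolyTime (a := .prod (.prod a b) c) N (fun x => ((e x, f x), g x)) f := snd.comp fst

/-- The third innermost variable of the environment. -/
theorem var₂ {e : X → a.Val} {f : X → b.Val} {g : X → c.Val} {h : X → s.Val} :
    PolyTime (a := .prod (.prod (.prod a b) c) s) N (fun x => (((e x, f x), g x), h x)) f :=
  var₁.comp fst

/-- The fourth innermost variable of the environment. -/
theorem var₃ {t : Ty} {e : X → a.Val} {f : X → b.Val} {g : X → c.Val} {h : X → s.Val}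
    {i : X → t.Val} :
    PolyTime (a := .prod (.prod (.prod (.prod a b) c) s) t) N
      (fun x => ((((e x, f x), g x), h x), i x)) f :=
  var₂.comp fst

/-! ### Sums, tables and access to list entries. -/

theorem foldl_add_eq_sum {m : ℕ} (f : Fin m → ℝ) :
    Fin.foldl m (fun t j => t + f j) 0 = ∑ j, f j := by
  induction m with
  | zero => simp
  | succ m ih => rw [Fin.foldl_succ_last, ih, Fin.sum_univ_castSucc]

theorem sum {m : X → ℕ} {f : ∀ x, Fin (m x) → ℝ} (hm : PolyTime (b := .nat) N ctx m)
    (hmN : ∀ x, m x ≤ N x)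
    (hf : PolyTime (X := Σ x, Fin (m x)) (a := .prod a .nat) (b := .real) (fun p => N p.1)
      (fun p => (ctx p.1, (p.2 : ℕ))) fun p => f p.1 p.2) :
    PolyTime (b := .real) N ctx fun x => ∑ j, f x j := by
  refine (loop (s := .real) (σ := fun _ => ℝ) (fun _ t => t) (fun x j t => t + f x j)
    (fun _ => 0) hm hmN ((realConst 0).congr fun _ => by simp) ?_).congr
    fun x => foldl_add_eq_sum _
  refine add (snd.comp snd) ?_
  refine (hf.reindex (Y := Σ x, Fin (m x) × ℝ) (N' := fun p => N p.1) (fun p => ⟨p.1, p.2.1⟩)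
    fun _ => le_rfl).comp (fst.pair (fst.comp snd))

theorem tabulate {m : X → ℕ} {f : ∀ x, Fin (m x) → b.Val} (hm : PolyTime (b := .nat) N ctx m)
    (hmN : ∀ x, m x ≤ N x)
    (hf : PolyTime (X := Σ x, Fin (m x)) (a := .prod a .nat) (fun p => N p.1)
      (fun p => (ctx p.1, (p.2 : ℕ))) fun p => f p.1 p.2) :
    PolyTime (b := .list b) N ctx fun x => List.ofFn (f x) := by
  -- `cons` adds at the front, so the entries are produced from the last index down.
  refine (loop (s := .list b) (σ := fun _ => List b.Val) (fun _ t => t)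
    (fun x j t => f x j.rev :: t) (fun _ => []) hm hmN nil ?_).congr fun x => ?_
  · refine cons ?_ (snd.comp snd)
    refine (hf.reindex (Y := Σ x, Fin (m x) × List b.Val) (N' := fun p => N p.1)
      (fun p => ⟨p.1, p.2.1.rev⟩) fun _ => le_rfl).comp (fst.pair ?_)
    refine (natSub (hm.wk (Y := fun x => Fin (m x) × List b.Val))
      (natAdd (fst.comp snd) (natConst 1))).congr fun p => ?_
    simp
  · exact Fin.foldl_rev (fun j t => f x j :: t) []

theorem nonempty_prog (a : Ty) : ∀ b : Ty, Nonempty (Prog a b)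
  | .bool => ⟨.comp .natLe (.pair (.natConst 0) (.natConst 0))⟩
  | .nat => ⟨.natConst 0⟩
  | .real => ⟨.realConst 0⟩
  | .prod b c => let ⟨p⟩ := nonempty_prog a b; let ⟨q⟩ := nonempty_prog a c; ⟨.pair p q⟩
  | .list _ => ⟨.nil⟩

theorem run_iterate_tail (l : List b.Val) (k : ℕ) :
    (fun z => (Prog.comp (.uncons .nil (.comp .snd .snd)) (.pair .id .id)
      : Prog (.list b) (.list b)).run z)^[k] l = l.drop k := by
  induction k generalizing l with
  | zero => simp
  | succ k ih =>
    rw [Function.iterate_succ_apply, ih]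
    cases l <;> simp [Prog.run]

/-- Entries of a vector. -/
theorem get {m : X → ℕ} {v : ∀ x, Fin (m x) → b.Val} {j : ∀ x, Fin (m x)}
    (hv : PolyTime (b := .list b) N ctx fun x => List.ofFn (v x))
    (hj : PolyTime (b := .nat) N ctx fun x => (j x : ℕ)) (hmN : ∀ x, m x ≤ N x) :
    PolyTime N ctx fun x => v x (j x) := by
  have hdrop : PolyTime (b := .list b) N ctx fun x => (List.ofFn (v x)).drop (j x) := by
    have : PolyTime (a := .prod .nat (.list b)) (b := .list b) N
        (fun x => ((j x : ℕ), List.ofFn (v x))) fun x => (List.ofFn (v x)).drop (j x) := by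
      refine ⟨.iter (.comp (.uncons .nil (.comp .snd .snd)) (.pair .id .id)),
        fun x => run_iterate_tail _ _, ?_⟩
      refine ((IsPoly.size.mul (IsPoly.const (N := N) 10)).add (IsPoly.const 1)).mono fun x => ?_
      simp only [Prog.steps, Nat.add_le_add_iff_right]
      refine (Finset.sum_le_card_nsmul _ _ 10 fun k _ => ?_).trans ?_
      · generalize (fun z => (Prog.comp (.uncons .nil (.comp .snd .snd)) (.pair .id .id)
          : Prog (.list b) (.list b)).run z)^[k] _ = l
        cases l <;> simp [Prog.run]
      · simp only [Finset.card_range, smul_eq_mul]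
        have := hmN x
        have := (j x).isLt
        gcongr
        omega
    exact this.comp (hj.pair hv)
  -- An arbitrary program for the empty-list branch, which an index in range never reaches.
  obtain ⟨q⟩ := nonempty_prog (.list b) b
  have hhead : PolyTime (a := .list b) N (fun x => (List.ofFn (v x)).drop (j x))
      fun x => v x (j x) := by
    have hcons : ∀ x, (List.ofFn (v x)).drop (j x) =
        v x (j x) :: (List.ofFn (v x)).drop (j x + 1) := fun x => by
      rw [List.drop_eq_getElem_cons (by simp)]
      simp
    refine ⟨.comp (.uncons q (.comp .fst .snd)) (.pair .id .id), fun x => ?_, ?_⟩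
    · simp only [Prog.run]
      rw [hcons]
    · refine (IsPoly.const 20).mono fun x => ?_
      simp only [Prog.steps, Prog.run]
      rw [hcons]
      simp
  exact hhead.comp hdrop

theorem length {m : X → ℕ} {v : ∀ x, Fin (m x) → b.Val}
    (hv : PolyTime (b := .list b) N ctx fun x => List.ofFn (v x)) (hmN : ∀ x, m x ≤ N x) :
    PolyTime (b := .nat) N ctx m := by
  let body : Prog (.prod .nat b) .nat := .comp .natAdd (.pair .fst (.natConst 1))
  have hrun : ∀ (l : List b.Val) (k : ℕ),
      (Prog.foldl body).run (k, l) = k + l.length := by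
    intro l
    induction l with
    | nil => intro k; simp [Prog.run]
    | cons y l ih =>
      intro k
      have := ih (k + 1)
      simp only [Prog.run, List.foldl_cons, body, List.length_cons] at this ⊢
      exact this.trans (by rw [Nat.add_assoc, Nat.add_comm 1])
  have hsteps : ∀ (l : List b.Val) (k : ℕ),
      (Prog.foldl body).steps (k, l) ≤ l.length * 10 + 1 := by
    intro l
    induction l with
    | nil => intro k; simp [Prog.steps, foldCost]
    | cons y l ih =>
      intro k
      have := ih (k + 1)
      simp only [Prog.run, Prog.steps, foldCost, body, List.length_cons] at this ⊢
      omega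
  refine comp (g := fun x => ((0, List.ofFn (v x)) : (Ty.prod .nat (.list b)).Val))
    ⟨.foldl body, fun x => ?_, ?_⟩ ((natConst 0).pair hv)
  · rw [hrun]; simp
  · refine ((IsPoly.size.mul (IsPoly.const (N := N) 10)).add (IsPoly.const 1)).mono fun x => ?_
    refine (hsteps _ _).trans ?_
    have := hmN x
    simp only [List.length_ofFn]
    omega

theorem getEntry {m : X → ℕ} {v : ∀ x, Fin (m x) → ℝ} {j : ∀ x, Fin (m x)} {f : X → ℝ}
    (hv : PolyTime (b := .list .real) N ctx fun x => encVec (v x))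
    (hj : PolyTime (b := .nat) N ctx fun x => (j x : ℕ)) (hmN : ∀ x, m x ≤ N x)
    (hf : ∀ x, v x (j x) = f x) : PolyTime (b := .real) N ctx f :=
  (get (b := .real) hv hj hmN).congr hf

theorem getRow {m d : X → ℕ} {A : ∀ x, Fin (m x) → Fin (d x) → ℝ} {i : ∀ x, Fin (m x)}
    {f : ∀ x, Fin (d x) → ℝ}
    (hA : PolyTime (b := .list (.list .real)) N ctx fun x => encMat (A x))
    (hi : PolyTime (b := .nat) N ctx fun x => (i x : ℕ)) (hmN : ∀ x, m x ≤ N x)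
    (hf : ∀ x, A x (i x) = f x) :
    PolyTime (b := .list .real) N ctx fun x => encVec (f x) :=
  (get (b := .list .real) (v := fun x i => List.ofFn (A x i)) hA hi hmN).congr
    fun x => by rw [hf]

/-- Entries of a matrix. -/
theorem getEntry₂ {m d : X → ℕ} {A : ∀ x, Fin (m x) → Fin (d x) → ℝ} {i : ∀ x, Fin (m x)}
    {j : ∀ x, Fin (d x)} {f : X → ℝ}
    (hA : PolyTime (b := .list (.list .real)) N ctx fun x => encMat (A x))
    (hi : PolyTime (b := .nat) N ctx fun x => (i x : ℕ))
    (hj : PolyTime (b := .nat) N ctx fun x => (j x : ℕ))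
    (hmN : ∀ x, m x ≤ N x) (hdN : ∀ x, d x ≤ N x) (hf : ∀ x, A x (i x) (j x) = f x) :
    PolyTime (b := .real) N ctx f :=
  getEntry (getRow hA hi hmN fun _ => rfl) hj hdN hf

end PolyTime

/-! ### The estimation algorithm -/

section Algorithm

open Classical in
/-- The weighted second-moment matrix with weights proportional to `c`, minus the identity. -/
noncomputable def centeredMoment {n d : ℕ} (S : Fin n → Fin d → ℝ) (c : Fin n → ℝ) :
    Fin d → Fin d → ℝ :=
  fun j l => (∑ i, c i * S i j * S i l) / (∑ i, c i) - if j = l then 1 else 0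

/-- The strict order on the entries of `A` by decreasing absolute value, ties being broken by
position. -/
def Before {d : ℕ} (A : Fin d → Fin d → ℝ) (p q : Fin d × Fin d) : Prop :=
  A q.1 q.2 ^ 2 < A p.1 p.2 ^ 2 ∨
    A q.1 q.2 ^ 2 ≤ A p.1 p.2 ^ 2 ∧ finProdFinEquiv p < finProdFinEquiv q

open Classical in
/-- The number of entries of `A` that precede a given one in the order `Before`. -/
noncomputable def entryRank {d : ℕ} (A : Fin d → Fin d → ℝ) (p : Fin d × Fin d) : ℝ :=
  ∑ j, ∑ l, if Before A (j, l) p then 1 else 0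

open Classical in
/-- The matrix of the `2k²` largest entries of `A`. -/
noncomputable def truncate {d : ℕ} (k : ℕ) (A : Fin d → Fin d → ℝ) : Fin d → Fin d → ℝ :=
  fun j l => if 2 * ((k : ℝ) * k) ≤ entryRank A (j, l) then 0 else A j l

/-- The squared Frobenius norm. -/
def sqNorm {d : ℕ} (A : Fin d → Fin d → ℝ) : ℝ := ∑ j, ∑ l, A j l ^ 2

/-- The quadratic form of `B`. -/
def quadForm {d : ℕ} (B : Fin d → Fin d → ℝ) (x : Fin d → ℝ) : ℝ := ∑ j, ∑ l, B j l * x j * x l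

open Classical in
/-- The number of indices at which `τ` is at least as large as at `i`. -/
noncomputable def upperCount {n : ℕ} (τ : Fin n → ℝ) (i : Fin n) : ℝ :=
  ∑ j, if τ i ≤ τ j then 1 else 0

open Classical in
/-- The maximum of `b` and the values of `g`. -/
noncomputable def maxFrom {n : ℕ} (b : ℝ) (g : Fin n → ℝ) : ℝ :=
  Fin.foldl n (fun s j => if s ≤ g j then g j else s) b

/-- A strict lower bound of the values of `τ`. -/
noncomputable def lowerBd {n : ℕ} (τ : Fin n → ℝ) : ℝ := -1 - ∑ i, τ i ^ 2

open Classical in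
/-- The upper `2ε`-quantile of the values of `τ`. -/
noncomputable def threshold {n : ℕ} (ε : ℝ) (τ : Fin n → ℝ) : ℝ :=
  maxFrom (lowerBd τ) fun i => if 2 * (ε * n) ≤ upperCount τ i then τ i else lowerBd τ

open Classical in
/-- The excess of `τ` over its upper quantile, at the indices with positive weight. -/
noncomputable def excess {n : ℕ} (ε : ℝ) (c τ : Fin n → ℝ) (i : Fin n) : ℝ :=
  if c i ≤ 0 then 0 else if τ i ≤ threshold ε τ then 0 else τ i - threshold ε τ

open Classical in
/-- The weights are decreased in proportion to the excess, so that one of them vanishes. -/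
noncomputable def reweight {n : ℕ} (ε : ℝ) (c τ : Fin n → ℝ) (i : Fin n) : ℝ :=
  if maxFrom 0 (excess ε c τ) ≤ 0 then c i
  else c i * (1 - excess ε c τ i / maxFrom 0 (excess ε c τ))

open Classical in
/-- One step of the filter: the weights are updated, and the best truncated moment matrix
encountered so far is kept. -/
noncomputable def filterStep {n d : ℕ} (k : ℕ) (ε : ℝ) (S : Fin n → Fin d → ℝ)
    (s : (Fin n → ℝ) × (Fin d → Fin d → ℝ)) : (Fin n → ℝ) × (Fin d → Fin d → ℝ) :=
  (reweight ε s.1 fun i => quadForm (truncate k (centeredMoment S s.1)) (S i),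
    if (1 - 2 * ε) * n ≤ ∑ i, s.1 i ∧
      sqNorm (truncate k (centeredMoment S s.1)) ≤ sqNorm s.2
    then truncate k (centeredMoment S s.1) else s.2)

/-- The sparse matrix found by the filter. -/
noncomputable def robustMatrix {n d : ℕ} (k : ℕ) (ε : ℝ) (S : Fin n → Fin d → ℝ) :
    Fin d → Fin d → ℝ :=
  (Fin.foldl n (fun s _ => filterStep k ε S s)
    (fun _ => 1, truncate k (centeredMoment S fun _ => 1))).2

/-- The normalized columns of `B`. -/
noncomputable def direction {d : ℕ} (B : Fin d → Fin d → ℝ) (j : Fin d) : Fin d → ℝ :=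
  fun l => B l j / Real.sqrt (∑ l', B l' j ^ 2)

open Classical in
/-- The normalized column of `B` that gives the best rank-one approximation of `B`. -/
noncomputable def principalDirection {d : ℕ} (B : Fin d → Fin d → ℝ) : Fin d → ℝ :=
  Fin.foldl d (fun u j =>
    if quadForm B (direction B j) ^ 2 ≤ quadForm B u ^ 2 then u else direction B j)
    fun l => if (l : ℕ) ≤ 0 then 1 else 0

end Algorithm

/-! ### The algorithm runs in polynomial time -/

namespace PolyTime

variable {X : Type} {N : X → ℕ} {a b c s : Ty} {ctx : X → a.Val} {n d k : X → ℕ}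
  {S : ∀ x, Fin (n x) → Fin (d x) → ℝ} {w τ : ∀ x, Fin (n x) → ℝ}
  {A : ∀ x, Fin (d x) → Fin (d x) → ℝ} {ε : X → ℝ}

theorem zero : PolyTime (b := .real) N ctx fun _ => (0 : ℝ) :=
  (realConst 0).congr fun _ => by simp

theorem one : PolyTime (b := .real) N ctx fun _ => (1 : ℝ) :=
  (realConst 1).congr fun _ => by simp

theorem two : PolyTime (b := .real) N ctx fun _ => (2 : ℝ) :=
  (realConst 2).congr fun _ => by simp

theorem sumEntries (hn : PolyTime (b := .nat) N ctx n) (hnN : ∀ x, n x ≤ N x)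
    (hw : PolyTime (b := .list .real) N ctx fun x => encVec (w x)) :
    PolyTime (b := .real) N ctx fun x => ∑ i, w x i :=
  sum hn hnN (getEntry hw.wk var₀ (fun _ => hnN _) fun _ => rfl)

theorem centeredMoment (hn : PolyTime (b := .nat) N ctx n) (hnN : ∀ x, n x ≤ N x)
    (hd : PolyTime (b := .nat) N ctx d) (hdN : ∀ x, d x ≤ N x)
    (hS : PolyTime (b := .list (.list .real)) N ctx fun x => encMat (S x))
    (hw : PolyTime (b := .list .real) N ctx fun x => encVec (w x)) :
    PolyTime (b := .list (.list .real)) N ctx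
      fun x => encMat (centeredMoment (S x) (w x)) := by
  classical
  refine tabulate hd hdN (tabulate hd.wk (fun _ => hdN _) (sub (div ?_ ?_) (ite ?_ one zero)))
  · exact sum hn.wk₂ (fun _ => hnN _)
      (mul (mul (getEntry hw.wk₃ var₀ (fun _ => hnN _) fun _ => rfl)
        (getEntry₂ hS.wk₃ var₀ var₂
          (fun _ => hnN _) (fun _ => hdN _) fun _ => rfl))
        (getEntry₂ hS.wk₃ var₀ var₁
          (fun _ => hnN _) (fun _ => hdN _) fun _ => rfl))
  · exact (sumEntries hn hnN hw).wk₂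
  · exact ((natLe var₁ var₀).and (natLe var₀ var₁)).congr
      fun p => by rw [← le_antisymm_iff, Fin.val_inj]

theorem before (hd : PolyTime (b := .nat) N ctx d) (hdN : ∀ x, d x ≤ N x)
    (hA : PolyTime (b := .list (.list .real)) N ctx fun x => encMat (A x))
    {i j i' j' : ∀ x, Fin (d x)}
    (hi : PolyTime (b := .nat) N ctx fun x => (i x : ℕ))
    (hj : PolyTime (b := .nat) N ctx fun x => (j x : ℕ))
    (hi' : PolyTime (b := .nat) N ctx fun x => (i' x : ℕ))
    (hj' : PolyTime (b := .nat) N ctx fun x => (j' x : ℕ)) :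
    PolyTest N ctx fun x => Before (A x) (i x, j x) (i' x, j' x) := by
  have h1 := (getEntry₂ hA hi hj hdN hdN fun _ => rfl).sq
  have h2 := (getEntry₂ hA hi' hj' hdN hdN fun _ => rfl).sq
  -- The position of entry `(i, j)` is `j + d * i`. Counters have no multiplication, so it is
  -- computed and compared in the reals.
  refine ((realLe h1 h2).not.or ((realLe h2 h1).and (realLe
    (hj'.natCast.add (hd.natCast.mul hi'.natCast))
    (hj.natCast.add (hd.natCast.mul hi.natCast))).not)).congr fun x => ?_
  simp only [Before, not_le, Fin.lt_def, finProdFinEquiv_apply_val]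
  norm_cast

theorem truncate (hd : PolyTime (b := .nat) N ctx d) (hdN : ∀ x, d x ≤ N x)
    (hk : PolyTime (b := .nat) N ctx k)
    (hA : PolyTime (b := .list (.list .real)) N ctx fun x => encMat (A x)) :
    PolyTime (b := .list (.list .real)) N ctx fun x => encMat (truncate (k x) (A x)) := by
  classical
  refine tabulate hd hdN (tabulate hd.wk (fun _ => hdN _) (ite (realLe (two.mul
    (hk.natCast.mul hk.natCast).wk₂) ?_) zero
    (getEntry₂ hA.wk₂ var₁ var₀ (fun _ => hdN _)
      (fun _ => hdN _) fun _ => rfl)))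
  refine sum hd.wk₂ (fun _ => hdN _) (sum hd.wk₃ (fun _ => hdN _)
    (ite ?_ one zero))
  exact before hd.wk₄ (fun _ => hdN _) hA.wk₄
    var₁ var₀ var₃ var₂

theorem sqNorm (hd : PolyTime (b := .nat) N ctx d) (hdN : ∀ x, d x ≤ N x)
    (hA : PolyTime (b := .list (.list .real)) N ctx fun x => encMat (A x)) :
    PolyTime (b := .real) N ctx fun x => sqNorm (A x) :=
  sum hd hdN (sum hd.wk (fun _ => hdN _) (getEntry₂ hA.wk₂ var₁ var₀ (fun _ => hdN _)
      (fun _ => hdN _) fun _ => rfl).sq)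

theorem quadForm (hd : PolyTime (b := .nat) N ctx d) (hdN : ∀ x, d x ≤ N x)
    (hA : PolyTime (b := .list (.list .real)) N ctx fun x => encMat (A x))
    {u : ∀ x, Fin (d x) → ℝ}
    (hu : PolyTime (b := .list .real) N ctx fun x => encVec (u x)) :
    PolyTime (b := .real) N ctx fun x => quadForm (A x) (u x) :=
  sum hd hdN (sum hd.wk (fun _ => hdN _) (mul (mul (getEntry₂ hA.wk₂ var₁ var₀ (fun _ => hdN _)
      (fun _ => hdN _) fun _ => rfl)
    (getEntry hu.wk₂ var₁ (fun _ => hdN _) fun _ => rfl))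
    (getEntry hu.wk₂ var₀ (fun _ => hdN _) fun _ => rfl)))

theorem maxFrom (hn : PolyTime (b := .nat) N ctx n) (hnN : ∀ x, n x ≤ N x) {r : X → ℝ}
    (hr : PolyTime (b := .real) N ctx r)
    (hτ : PolyTime (X := Σ x, Fin (n x)) (a := .prod a .nat) (b := .real) (fun p => N p.1)
      (fun p => (ctx p.1, (p.2 : ℕ))) fun p => τ p.1 p.2) :
    PolyTime (b := .real) N ctx fun x => maxFrom (r x) (τ x) := by
  classical
  have h : PolyTime (X := Σ x, Fin (n x) × ℝ) (a := .prod a (.prod .nat .real)) (b := .real)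
      (fun p => N p.1) (fun p => (ctx p.1, ((p.2.1 : ℕ), p.2.2))) fun p => τ p.1 p.2.1 :=
    (hτ.reindex (Y := Σ x, Fin (n x) × ℝ) (N' := fun p => N p.1) (fun p => ⟨p.1, p.2.1⟩)
      fun _ => le_rfl).comp (fst.pair (fst.comp snd))
  exact loop (s := .real) (σ := fun _ => ℝ) (fun _ t => t) _ _ hn hnN hr
    (ite (realLe (snd.comp snd) h) h (snd.comp snd))

theorem lowerBd (hn : PolyTime (b := .nat) N ctx n) (hnN : ∀ x, n x ≤ N x)
    (hτ : PolyTime (b := .list .real) N ctx fun x => encVec (τ x)) :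
    PolyTime (b := .real) N ctx fun x => lowerBd (τ x) :=
  sub ((realConst (-1)).congr fun _ => by simp) (sum hn hnN
    (getEntry hτ.wk var₀ (fun _ => hnN _) fun _ => rfl).sq)

theorem threshold (hn : PolyTime (b := .nat) N ctx n) (hnN : ∀ x, n x ≤ N x)
    (hε : PolyTime (b := .real) N ctx ε)
    (hτ : PolyTime (b := .list .real) N ctx fun x => encVec (τ x)) :
    PolyTime (b := .real) N ctx fun x => threshold (ε x) (τ x) := by
  classical
  have hl := lowerBd hn hnN hτ
  refine maxFrom hn hnN hl (ite (realLe (two.mul (hε.mul hn.natCast)).wk ?_)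
    (getEntry hτ.wk var₀ (fun _ => hnN _) fun _ => rfl) hl.wk)
  exact sum hn.wk (fun _ => hnN _) (ite (realLe
    (getEntry hτ.wk₂ var₁ (fun _ => hnN _) fun _ => rfl)
    (getEntry hτ.wk₂ var₀ (fun _ => hnN _) fun _ => rfl)) one zero)

theorem reweight (hn : PolyTime (b := .nat) N ctx n) (hnN : ∀ x, n x ≤ N x)
    (hε : PolyTime (b := .real) N ctx ε)
    (hw : PolyTime (b := .list .real) N ctx fun x => encVec (w x))
    (hτ : PolyTime (b := .list .real) N ctx fun x => encVec (τ x)) :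
    PolyTime (b := .list .real) N ctx fun x => encVec (reweight (ε x) (w x) (τ x)) := by
  classical
  have ht := threshold hn hnN hε hτ
  have hwi := getEntry (f := fun p : Σ x, Fin (n x) => w p.1 p.2) hw.wk var₀
    (fun _ => hnN _) fun _ => rfl
  have hτi := getEntry (f := fun p : Σ x, Fin (n x) => τ p.1 p.2) hτ.wk var₀
    (fun _ => hnN _) fun _ => rfl
  have he := ite (realLe hwi zero) zero (ite (realLe hτi ht.wk) zero (hτi.sub ht.wk))
  have hm := maxFrom (τ := fun x => excess (ε x) (w x) (τ x)) hn hnN zero he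
  exact tabulate hn hnN (ite (realLe hm.wk zero) hwi (hwi.mul (one.sub (he.div hm.wk))))

theorem robustMatrix (hn : PolyTime (b := .nat) N ctx n) (hnN : ∀ x, n x ≤ N x)
    (hd : PolyTime (b := .nat) N ctx d) (hdN : ∀ x, d x ≤ N x)
    (hk : PolyTime (b := .nat) N ctx k) (hε : PolyTime (b := .real) N ctx ε)
    (hS : PolyTime (b := .list (.list .real)) N ctx fun x => encMat (S x)) :
    PolyTime (b := .list (.list .real)) N ctx
      fun x => encMat (robustMatrix (k x) (ε x) (S x)) := by
  classical
  have hones : PolyTime (b := .list .real) N ctx fun x => encVec fun _ : Fin (n x) => (1 : ℝ) :=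
    tabulate hn hnN one
  refine snd.comp (loop (s := .prod (.list .real) (.list (.list .real)))
    (σ := fun x => (Fin (n x) → ℝ) × (Fin (d x) → Fin (d x) → ℝ))
    (fun _ t => (encVec t.1, encMat t.2)) (fun x _ t => filterStep (k x) (ε x) (S x) t)
    (fun x => (fun _ => 1, RobustSparsePCA.truncate (k x)
      (RobustSparsePCA.centeredMoment (S x) fun _ => 1))) hn hnN
    (hones.pair (truncate hd hdN hk (centeredMoment hn hnN hd hdN hS hones))) ?_)
  have hw : PolyTime (X := Σ x, Fin (n x) × ((Fin (n x) → ℝ) × (Fin (d x) → Fin (d x) → ℝ)))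
      (a := .prod a (.prod .nat (.prod (.list .real) (.list (.list .real)))))
      (b := .list .real) (fun p => N p.1)
      (fun p => (ctx p.1, ((p.2.1 : ℕ), (encVec p.2.2.1, encMat p.2.2.2))))
      fun p => encVec p.2.2.1 := fst.comp (snd.comp snd)
  have hB : PolyTime (X := Σ x, Fin (n x) × ((Fin (n x) → ℝ) × (Fin (d x) → Fin (d x) → ℝ)))
      (a := .prod a (.prod .nat (.prod (.list .real) (.list (.list .real)))))
      (b := .list (.list .real)) (fun p => N p.1)
      (fun p => (ctx p.1, ((p.2.1 : ℕ), (encVec p.2.2.1, encMat p.2.2.2))))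
      fun p => encMat p.2.2.2 := snd.comp (snd.comp snd)
  have hT := truncate hd.wk (fun _ => hdN _) hk.wk
    (centeredMoment hn.wk (fun _ => hnN _)
      hd.wk (fun _ => hdN _) hS.wk hw)
  refine pair (reweight hn.wk (fun _ => hnN _) hε.wk hw
    (tabulate hn.wk (fun _ => hnN _) (quadForm hd.wk₂
      (fun _ => hdN _) hT.wk (getRow hS.wk₂ var₀ (fun _ => hnN _)
        fun _ => rfl)))) ?_
  have hmass := sumEntries hn.wk (fun _ => hnN _) hw
  refine (ite (((realLe ((one.sub (two.mul hε)).mul hn.natCast).wk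
    hmass).and
    (realLe (sqNorm hd.wk (fun _ => hdN _) hT) (sqNorm hd.wk (fun _ => hdN _) hB)))) hT
    hB).congr fun p => ?_
  simp only [filterStep]
  split_ifs <;> rfl

theorem principalDirection (hd : PolyTime (b := .nat) N ctx d) (hdN : ∀ x, d x ≤ N x)
    (hA : PolyTime (b := .list (.list .real)) N ctx fun x => encMat (A x)) :
    PolyTime (b := .list .real) N ctx fun x => encVec (principalDirection (A x)) := by
  classical
  refine loop (s := .list .real) (σ := fun x => Fin (d x) → ℝ) (fun _ t => encVec t)
    _ _ hd hdN (tabulate hd hdN (ite (natLe var₀ (natConst 0)) one zero)) ?_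
  have hu : PolyTime (X := Σ x, Fin (d x) × (Fin (d x) → ℝ))
      (a := .prod a (.prod .nat (.list .real))) (b := .list .real) (fun p => N p.1)
      (fun p => (ctx p.1, ((p.2.1 : ℕ), encVec p.2.2))) fun p => encVec p.2.2 := snd.comp snd
  have hj : PolyTime (X := Σ x, Fin (d x) × (Fin (d x) → ℝ))
      (a := .prod a (.prod .nat (.list .real))) (b := .nat) (fun p => N p.1)
      (fun p => (ctx p.1, ((p.2.1 : ℕ), encVec p.2.2))) fun p => (p.2.1 : ℕ) := fst.comp snd
  have hD : PolyTime (X := Σ x, Fin (d x) × (Fin (d x) → ℝ))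
      (a := .prod a (.prod .nat (.list .real))) (b := .list .real) (fun p => N p.1)
      (fun p => (ctx p.1, ((p.2.1 : ℕ), encVec p.2.2)))
      fun p => encVec (direction (A p.1) p.2.1) :=
    tabulate hd.wk (fun _ => hdN _) ((getEntry₂ hA.wk₂ var₀ hj.wk (fun _ => hdN _)
      (fun _ => hdN _) fun _ => rfl).div (sum hd.wk₂ (fun _ => hdN _)
        (getEntry₂ hA.wk₃ var₀ hj.wk₂ (fun _ => hdN _)
      (fun _ => hdN _) fun _ => rfl).sq).sqrt)
  refine (ite (realLe (quadForm hd.wk (fun _ => hdN _) hA.wk hD).sq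
    (quadForm hd.wk (fun _ => hdN _) hA.wk hu).sq)
    hu hD).congr fun p => ?_
  split_ifs <;> rfl

end PolyTime

theorem exists_polyTime_estimator :
    ∃ (c : ℕ) (alg : Prog inputTy outputTy),
      (∀ (n d k : ℕ) (ε : ℝ) (S : Fin n → Fin d → ℝ),
        alg.steps (encodeInput S k ε) ≤ c * (n + d + 1) ^ c) ∧
      ∀ (n d k : ℕ) (ε : ℝ) (S : Fin n → Fin d → ℝ), 0 < n →
        alg.run (encodeInput S k ε) = List.ofFn (principalDirection (robustMatrix k ε S)) := by
  classical
  -- The program reads `d` off the length of the first sample, hence environments have at least one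
  -- sample.
  let X := Σ p : ℕ × ℕ, (Fin (p.1 + 1) → Fin p.2 → ℝ) × ℕ × ℝ
  let N : X → ℕ := fun x => x.1.1 + 1 + x.1.2
  let ctx : X → inputTy.Val := fun x => encodeInput x.2.1 x.2.2.1 x.2.2.2
  have hnN : ∀ x : X, x.1.1 + 1 ≤ N x := fun x => by simp only [N]; omega
  have hdN : ∀ x : X, x.1.2 ≤ N x := fun x => by simp only [N]; omega
  have hS : PolyTime (b := .list (.list .real)) N ctx fun x => encMat x.2.1 := PolyTime.fst
  have hk : PolyTime (b := .nat) N ctx fun x => x.2.2.1 :=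
    PolyTime.fst.comp (PolyTime.snd (b := .list (.list .real)))
  have hε : PolyTime (b := .real) N ctx fun x => x.2.2.2 :=
    PolyTime.snd.comp (PolyTime.snd (b := .list (.list .real)))
  have hn : PolyTime (b := .nat) N ctx fun x => x.1.1 + 1 :=
    PolyTime.length (b := .list .real) hS hnN
  have hd : PolyTime (b := .nat) N ctx fun x => x.1.2 :=
    PolyTime.length (b := .real) (PolyTime.get (b := .list .real)
      (v := fun x : X => fun i => List.ofFn (x.2.1 i)) (j := fun _ => 0) hS
      ((PolyTime.natConst 0).congr fun x => by simp) hnN) hdN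
  obtain ⟨p, hp, e, he⟩ := PolyTime.principalDirection hd hdN
    (PolyTime.robustMatrix hn hnN hd hdN hk hε hS)
  -- The wrapper returns the empty list when there are no samples, and otherwise reassembles the
  -- input and runs `p`. The 20 pays for this overhead.
  refine ⟨e + 20, .comp (.uncons .nil (.comp p (.pair (.comp .cons .snd) .fst)))
    (.pair .snd .fst), fun n d k ε S => ?_, fun n d k ε S hn => ?_⟩
  · rcases n with _ | n
    · simp [Prog.steps, Prog.run, encodeInput]
      nlinarith [Nat.one_le_pow (e + 20) (d + 1) (by omega)]
    · have := he ⟨(n, d), S, k, ε⟩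
      simp only [N, ctx, encodeInput] at this
      simp only [Prog.steps, Prog.run, encodeInput, List.ofFn_succ] at this ⊢
      have h1 : (n + 1 + d + 1) ^ e ≤ (n + 1 + d + 1) ^ (e + 20) :=
        Nat.pow_le_pow_right (by omega) (by omega)
      have h2 : 1 ≤ (n + 1 + d + 1) ^ (e + 20) := Nat.one_le_pow _ _ (by omega)
      have h3 := Nat.mul_le_mul_left e h1
      rw [add_mul]
      omega
  · rcases n with _ | n
    · omega
    · have := hp ⟨(n, d), S, k, ε⟩
      simp only [ctx, encodeInput] at this
      simp only [Prog.run, encodeInput, List.ofFn_succ] at this ⊢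
      exact this

/-! ### Maxima and quantiles -/

theorem foldl_const_eq_iterate {α : Type*} (F : α → α) (n : ℕ) (x : α) :
    Fin.foldl n (fun s _ => F s) x = F^[n] x := by
  induction n with
  | zero => simp
  | succ n ih => rw [Fin.foldl_succ_last, ih, Function.iterate_succ_apply']

theorem maxFrom_spec {n : ℕ} (b : ℝ) (g : Fin n → ℝ) :
    b ≤ maxFrom b g ∧ (∀ j, g j ≤ maxFrom b g) ∧ (maxFrom b g = b ∨ ∃ j, maxFrom b g = g j) := by
  induction n with
  | zero => simp [maxFrom]
  | succ n ih =>
    obtain ⟨h1, h2, h3⟩ := ih fun j => g j.castSucc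
    have hs : maxFrom b g = if maxFrom b (fun j => g j.castSucc) ≤ g (Fin.last n)
        then g (Fin.last n) else maxFrom b fun j => g j.castSucc := by
      simp only [maxFrom]
      rw [Fin.foldl_succ_last]
    rw [hs]
    split_ifs with h
    · refine ⟨h1.trans h, fun j => ?_, Or.inr ⟨_, rfl⟩⟩
      refine Fin.lastCases le_rfl (fun j => (h2 j).trans h) j
    · refine ⟨h1, fun j => ?_, h3.imp_right fun ⟨j, hj⟩ => ⟨_, hj⟩⟩
      exact Fin.lastCases (not_le.1 h).le h2 j

theorem lowerBd_lt {n : ℕ} (τ : Fin n → ℝ) (i : Fin n) : lowerBd τ < τ i := by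
  have : τ i ^ 2 ≤ ∑ j, τ j ^ 2 :=
    Finset.single_le_sum (f := fun j => τ j ^ 2) (fun j _ => sq_nonneg _) (Finset.mem_univ i)
  simp only [lowerBd]
  nlinarith [sq_nonneg (τ i + 1)]

theorem upperCount_eq {n : ℕ} (τ : Fin n → ℝ) (i : Fin n) :
    upperCount τ i = ((Finset.univ.filter fun j => τ i ≤ τ j).card : ℝ) := by
  simp [upperCount]

/-- The threshold is the largest score with at least `2εn` scores at or above it. The minimal score
qualifies, so the default `lowerBd` is never selected; and were more than `2εn` scores strictly
above the threshold, the least of them would be a larger candidate. -/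
theorem threshold_spec {n : ℕ} (hn : 0 < n) {ε : ℝ} (hε : 0 < ε) (hε' : 2 * ε ≤ 1)
    (τ : Fin n → ℝ) :
    2 * (ε * n) ≤ ((Finset.univ.filter fun j => threshold ε τ ≤ τ j).card : ℝ) ∧
    ((Finset.univ.filter fun j => threshold ε τ < τ j).card : ℝ) ≤ 2 * (ε * n) := by
  classical
  have hn' : (0 : ℝ) < n := by exact_mod_cast hn
  obtain ⟨-, h2, h3⟩ := maxFrom_spec (lowerBd τ)
    fun i => if 2 * (ε * n) ≤ upperCount τ i then τ i else lowerBd τ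
  change ∀ j, _ ≤ threshold ε τ at h2
  change threshold ε τ = _ ∨ ∃ j, threshold ε τ = _ at h3
  have : Nonempty (Fin n) := ⟨⟨0, hn⟩⟩
  obtain ⟨i₀, hi₀⟩ := Finite.exists_min τ
  have hc0 : 2 * (ε * n) ≤ upperCount τ i₀ := by
    rw [upperCount_eq, Finset.filter_true_of_mem fun j _ => hi₀ j]
    simp only [Finset.card_univ, Fintype.card_fin]
    nlinarith
  have hlt : lowerBd τ < threshold ε τ := by
    have := h2 i₀
    rw [if_pos hc0] at this
    exact (lowerBd_lt τ i₀).trans_le this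
  constructor
  · rcases h3 with h3 | ⟨j, hj⟩
    · exact absurd h3 hlt.ne'
    · split_ifs at hj with h
      · rwa [upperCount_eq, ← hj] at h
      · exact absurd hj hlt.ne'
  · by_contra hcon
    push Not at hcon
    have hne : (Finset.univ.filter fun j => threshold ε τ < τ j).Nonempty := by
      rw [← Finset.card_pos]
      have : (0 : ℝ) < ((Finset.univ.filter fun j => threshold ε τ < τ j).card : ℝ) :=
        lt_trans (by positivity) hcon
      exact_mod_cast this
    obtain ⟨i, hi, hmin⟩ := Finset.exists_min_image _ τ hne
    have hi' := (Finset.mem_filter.1 hi).2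
    have h4 : 2 * (ε * n) ≤ upperCount τ i := by
      rw [upperCount_eq]
      refine hcon.le.trans ?_
      exact_mod_cast Finset.card_le_card fun j hj => by
        simpa using hmin j hj
    have := h2 i
    rw [if_pos h4] at this
    linarith

/-- The common factor is `r = 1 / m`, with `m` the largest excess. Since `excess` vanishes at dead
samples, a positive maximum is attained at a live one, whose new weight is exactly 0. -/
theorem reweight_spec {n : ℕ} (ε : ℝ) {c : Fin n → ℝ} (hc : ∀ i, 0 ≤ c i) (τ : Fin n → ℝ) :
    (∀ i, 0 ≤ reweight ε c τ i ∧ reweight ε c τ i ≤ c i) ∧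
    (∃ r, 0 ≤ r ∧ ∀ i, c i - reweight ε c τ i = r * (c i * max (τ i - threshold ε τ) 0)) ∧
    ((∃ i, 0 < c i ∧ threshold ε τ < τ i) → ∃ i, 0 < c i ∧ reweight ε c τ i = 0) := by
  classical
  obtain ⟨h1, h2, h3⟩ := maxFrom_spec 0 (excess ε c τ)
  set m := maxFrom 0 (excess ε c τ) with hm
  have he0 : ∀ i, 0 ≤ excess ε c τ i := fun i => by
    simp only [excess]
    split_ifs with h h'
    · exact le_rfl
    · exact le_rfl
    · linarith
  have hce : ∀ i, c i * excess ε c τ i = c i * max (τ i - threshold ε τ) 0 := fun i => by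
    simp only [excess]
    split_ifs with h h'
    · rw [le_antisymm h (hc i)]; simp
    · rw [max_eq_right (by linarith)]
    · rw [max_eq_left (by linarith)]
  by_cases hm0 : m ≤ 0
  · have hr : reweight ε c τ = c := funext fun i => by simp [reweight, ← hm, hm0]
    rw [hr]
    refine ⟨fun i => ⟨hc i, le_rfl⟩, ⟨0, le_rfl, by simp⟩, fun ⟨i, hi, hi'⟩ => ?_⟩
    have := h2 i
    simp only [excess, if_neg (not_le.2 hi), if_neg (not_le.2 hi')] at this
    linarith
  · have hr : ∀ i, reweight ε c τ i = c i * (1 - excess ε c τ i / m) := fun i => by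
      simp [reweight, ← hm, hm0]
    have hm0 := not_le.1 hm0
    have hq : ∀ i, 0 ≤ excess ε c τ i / m ∧ excess ε c τ i / m ≤ 1 := fun i =>
      ⟨div_nonneg (he0 i) h1, (div_le_one hm0).2 (h2 i)⟩
    refine ⟨fun i => ?_, ⟨1 / m, by positivity, fun i => ?_⟩, fun _ => ?_⟩
    · rw [hr]
      obtain ⟨hq1, hq2⟩ := hq i
      exact ⟨mul_nonneg (hc i) (by linarith), mul_le_of_le_one_right (hc i) (by linarith)⟩
    · rw [hr, ← hce]
      ring
    · rcases h3 with h3 | ⟨j, hj⟩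
      · exact absurd h3 hm0.ne'
      · refine ⟨j, ?_, ?_⟩
        · by_contra h
          simp only [excess, if_pos (not_lt.1 h)] at hj
          exact hm0.ne' hj
        · rw [hr, ← hj, div_self hm0.ne']
          simp

/-! ### Consequences of stability -/

section Tail

variable {n : ℕ} {ε D : ℝ} {y : Fin n → ℝ}

/-- All weighted means of `y` are at most `D` in absolute value. -/
def MeanBound (ε D : ℝ) (y : Fin n → ℝ) : Prop := ∀ w ∈ weights n (2 * ε), |∑ i, w i * y i| ≤ D

/-- Removing mass at most `2εn` from the uniform weights and normalizing stays inside `weights n (2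
* ε)`. -/
theorem MeanBound.abs_sum_one_sub_le (hy : MeanBound ε D y) (hn : 0 < n) (hε : ε ≤ 1 / 20)
    (hD : 0 ≤ D) {h : Fin n → ℝ} (h0 : ∀ i, 0 ≤ h i) (h1 : ∀ i, h i ≤ 1)
    (hs : ∑ i, h i ≤ 2 * (ε * n)) : |∑ i, (1 - h i) * y i| ≤ D * n := by
  have hn' : (0 : ℝ) < n := by exact_mod_cast hn
  have hsum : ∑ i, (1 - h i) = n - ∑ i, h i := by simp
  have hs0 : 0 ≤ ∑ i, h i := Finset.sum_nonneg fun i _ => h0 i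
  set W := n - ∑ i, h i with hW
  have hε0 : (1 - 2 * ε) * n ≤ W := by linarith
  have hε1 : 0 < (1 - 2 * ε) * n := by
    have : 0 < 1 - 2 * ε := by linarith
    positivity
  have hWpos : 0 < W := hε1.trans_le hε0
  have hmem : (fun i => (1 - h i) / W) ∈ weights n (2 * ε) := by
    refine ⟨fun i => ⟨div_nonneg (by linarith [h1 i]) hWpos.le, ?_⟩, ?_⟩
    · exact div_le_div₀ zero_le_one (by linarith [h0 i]) hε1 hε0
    · rw [← Finset.sum_div, hsum, div_self hWpos.ne']
  have := hy _ hmem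
  have he : ∑ i, (1 - h i) / W * y i = (∑ i, (1 - h i) * y i) / W := by
    rw [Finset.sum_div]
    exact Finset.sum_congr rfl fun i _ => by ring
  rw [he, abs_div, abs_of_pos hWpos, div_le_iff₀ hWpos] at this
  exact this.trans (mul_le_mul_of_nonneg_left (by linarith) hD)

/-- The removed part is the difference between the full sum and the remainder, each at most `D * n`.
The primed versions reach mass `4εn` by halving `h`. -/
theorem MeanBound.abs_sum_le (hy : MeanBound ε D y) (hn : 0 < n) (hε0 : 0 ≤ ε) (hε : ε ≤ 1 / 20)
    (hD : 0 ≤ D) {h : Fin n → ℝ} (h0 : ∀ i, 0 ≤ h i) (h1 : ∀ i, h i ≤ 1)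
    (hs : ∑ i, h i ≤ 2 * (ε * n)) : |∑ i, h i * y i| ≤ 2 * (D * n) := by
  have ha := hy.abs_sum_one_sub_le hn hε hD h0 h1 hs
  have hb := hy.abs_sum_one_sub_le hn hε hD (h := fun _ => 0) (fun _ => le_rfl)
    (fun _ => zero_le_one) (by simp; positivity)
  have : ∑ i, h i * y i = ∑ i, (1 - 0) * y i - ∑ i, (1 - h i) * y i := by
    rw [← Finset.sum_sub_distrib]
    exact Finset.sum_congr rfl fun i _ => by ring
  rw [this]
  exact (abs_sub _ _).trans (by linarith)

theorem MeanBound.abs_sum_le' (hy : MeanBound ε D y) (hn : 0 < n) (hε0 : 0 ≤ ε)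
    (hε : ε ≤ 1 / 20) (hD : 0 ≤ D) {h : Fin n → ℝ} (h0 : ∀ i, 0 ≤ h i) (h1 : ∀ i, h i ≤ 1)
    (hs : ∑ i, h i ≤ 4 * (ε * n)) : |∑ i, h i * y i| ≤ 4 * (D * n) := by
  have := hy.abs_sum_le hn hε0 hε hD (h := fun i => h i / 2) (fun i => by linarith [h0 i])
    (fun i => by linarith [h1 i]) (by rw [← Finset.sum_div]; linarith)
  have he : ∑ i, h i / 2 * y i = (∑ i, h i * y i) / 2 := by
    rw [Finset.sum_div]
    exact Finset.sum_congr rfl fun i _ => by ring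
  rw [he, abs_div, abs_of_pos (by norm_num : (0 : ℝ) < 2)] at this
  linarith

theorem MeanBound.abs_sum_one_sub_le' (hy : MeanBound ε D y) (hn : 0 < n) (hε0 : 0 ≤ ε)
    (hε : ε ≤ 1 / 20) (hD : 0 ≤ D) {h : Fin n → ℝ} (h0 : ∀ i, 0 ≤ h i) (h1 : ∀ i, h i ≤ 1)
    (hs : ∑ i, h i ≤ 4 * (ε * n)) : |∑ i, (1 - h i) * y i| ≤ 5 * (D * n) := by
  have ha := hy.abs_sum_le' hn hε0 hε hD h0 h1 hs
  have hb := hy.abs_sum_one_sub_le hn hε hD (h := fun _ => 0) (fun _ => le_rfl)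
    (fun _ => zero_le_one) (by simp; positivity)
  have : ∑ i, (1 - h i) * y i = ∑ i, (1 - 0) * y i - ∑ i, h i * y i := by
    rw [← Finset.sum_sub_distrib]
    exact Finset.sum_congr rfl fun i _ => by ring
  rw [this]
  exact (abs_sub _ _).trans (by linarith)

variable {μ : ℝ} {τ c : Fin n → ℝ} {E : Finset (Fin n)}

/-- The excess over the upper quantile is carried by the corrupted samples, whenever the weighted
mean of the scores is too large. -/
theorem sum_excess_lt (hy : MeanBound ε D y) (hn : 0 < n) (hε0 : 0 < ε) (hε : ε ≤ 1 / 20)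
    (hD : 0 ≤ D) (hE : (E.card : ℝ) ≤ ε * n) (hτ : ∀ i, i ∉ E → τ i = y i + μ)
    (hc0 : ∀ i, 0 ≤ c i) (hc1 : ∀ i, c i ≤ 1)
    (hgood : ∑ i ∈ Eᶜ, (1 - c i) ≤ ∑ i ∈ E, (1 - c i))
    (hbig : 14 * D * ∑ i, c i < ∑ i, c i * (τ i - μ)) :
    ∑ i ∈ Eᶜ, c i * max (τ i - threshold ε τ) 0 <
      ∑ i ∈ E, c i * max (τ i - threshold ε τ) 0 := by
  classical
  have hn' : (0 : ℝ) < n := by exact_mod_cast hn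
  have hDn : 0 ≤ D * n := by positivity
  obtain ⟨ht1, ht2⟩ := threshold_spec hn hε0 (by linarith) τ
  set t := threshold ε τ with ht
  have hEsum : ∑ i ∈ E, (1 - c i) ≤ ε * n := by
    refine le_trans ?_ hE
    have := Finset.sum_le_card_nsmul E (fun i => 1 - c i) 1 fun i _ => by linarith [hc0 i]
    simpa using this
  have hW : (1 - 2 * ε) * n ≤ ∑ i, c i := by
    have h1 : ∑ i, (1 - c i) = n - ∑ i, c i := by simp
    have h2 := Finset.sum_add_sum_compl E fun i => 1 - c i
    linarith
  -- the good samples have a small mean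
  have hgoodmean : |∑ i ∈ Eᶜ, c i * (τ i - μ)| ≤ D * n := by
    -- Delete `E` and the weight already lost by good samples: `hgood` bounds the latter by the loss
    -- on `E`, so the total is at most `2εn`.
    have := hy.abs_sum_one_sub_le hn hε hD (h := fun i => if i ∈ E then 1 else 1 - c i)
      (fun i => by split_ifs <;> linarith [hc1 i]) (fun i => by split_ifs <;> linarith [hc0 i]) ?_
    · convert this using 2
      rw [← Finset.sum_add_sum_compl E fun i => (1 - if i ∈ E then 1 else 1 - c i) * y i,
        Finset.sum_eq_zero (s := E) fun i hi => by simp [hi], zero_add]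
      refine Finset.sum_congr rfl fun i hi => ?_
      have hi := Finset.mem_compl.1 hi
      rw [hτ i hi, if_neg hi]
      ring
    · rw [← Finset.sum_add_sum_compl E, Finset.sum_congr rfl fun i hi => if_pos hi,
        Finset.sum_congr (s₁ := Eᶜ) rfl fun i hi => if_neg (Finset.mem_compl.1 hi)]
      simp only [Finset.sum_const, nsmul_eq_mul, mul_one]
      linarith
  -- the quantile is not much above the mean
  have hupper : ε * (t - μ) ≤ 2 * D := by
    -- At least `2εn - εn` good samples lie at or above `t`. Mass exactly `εn` spread evenly over
    -- them gives `εn(t - μ) ≤ 2Dn`.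
    set P := Finset.univ.filter fun i => i ∉ E ∧ t ≤ τ i with hP
    have hPcard : ε * n ≤ (P.card : ℝ) := by
      have h1 : (Finset.univ.filter fun i => t ≤ τ i).card ≤ E.card + P.card := by
        refine (Finset.card_le_card fun i hi => ?_).trans (Finset.card_union_le E P)
        by_cases h : i ∈ E
        · simp [h]
        · simp only [Finset.mem_union, hP, Finset.mem_filter]
          exact Or.inr ⟨Finset.mem_univ _, h, (Finset.mem_filter.1 hi).2⟩
      have h2 : ((Finset.univ.filter fun i => t ≤ τ i).card : ℝ) ≤ E.card + P.card := by
        exact_mod_cast h1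
      linarith
    have hεn : 0 < ε * n := by positivity
    have hPpos : (0 : ℝ) < P.card := hεn.trans_le hPcard
    have hr0 : 0 ≤ ε * n / P.card := by positivity
    have hsumh : ∑ i, (if i ∈ P then ε * n / P.card else 0) = ε * n := by
      rw [Finset.sum_ite_mem, Finset.univ_inter, Finset.sum_const, nsmul_eq_mul]
      field_simp
    have h1 := hy.abs_sum_le hn hε0.le hε hD (h := fun i => if i ∈ P then ε * n / P.card else 0)
      (fun i => by split_ifs <;> simp [hr0])
      (fun i => by split_ifs; exacts [(div_le_one hPpos).2 hPcard, zero_le_one])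
      (by rw [hsumh]; linarith)
    have h2 : ∑ i, (if i ∈ P then ε * n / P.card else 0) * (t - μ) ≤
        ∑ i, (if i ∈ P then ε * n / P.card else 0) * y i := by
      refine Finset.sum_le_sum fun i _ => ?_
      split_ifs with hi
      · obtain ⟨-, hi1, hi2⟩ := Finset.mem_filter.1 hi
        rw [hτ i hi1] at hi2
        exact mul_le_mul_of_nonneg_left (by linarith) hr0
      · simp
    rw [← Finset.sum_mul, hsumh] at h2
    have h3 : n * (ε * (t - μ)) ≤ n * (2 * D) := by linarith [le_of_abs_le h1]
    exact le_of_mul_le_mul_left h3 hn'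
  have hcount : ∀ F : Finset (Fin n), (∀ i ∈ F, t < τ i) → (F.card : ℝ) ≤ 2 * (ε * n) := by
    intro F hF
    have : F ⊆ Finset.univ.filter fun i => t < τ i := fun i hi => by simpa using hF i hi
    exact le_trans (by exact_mod_cast Finset.card_le_card this) ht2
  -- the quantile is not much below the mean
  have hlower : -(10 * D) ≤ t - μ := by
    by_contra hcon
    push Not at hcon
    -- Delete `E` and everything above `t`. At least `n/2` good samples remain, all with `y i ≤ t -
    -- μ < -10D`, so their sum would be below `-5Dn`.
    have hsumh : ∑ i, (if i ∈ E ∨ t < τ i then (1 : ℝ) else 0) ≤ 3 * (ε * n) := by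
      rw [Finset.sum_boole, Finset.filter_or]
      have h1 := Finset.card_union_le (Finset.univ.filter fun i => i ∈ E)
        (Finset.univ.filter fun i => t < τ i)
      have h2 : (((Finset.univ.filter fun i => i ∈ E) ∪
        (Finset.univ.filter fun i => t < τ i)).card : ℝ) ≤
        (Finset.univ.filter fun i => i ∈ E).card + (Finset.univ.filter fun i => t < τ i).card := by
        exact_mod_cast h1
      rw [Finset.filter_mem_eq_inter, Finset.univ_inter] at h2 ⊢
      linarith
    have h1 := hy.abs_sum_one_sub_le' hn hε0.le hε hD
      (h := fun i => if i ∈ E ∨ t < τ i then (1 : ℝ) else 0)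
      (fun i => by split_ifs <;> simp) (fun i => by split_ifs <;> simp)
      (hsumh.trans (by nlinarith))
    have h2 : ∑ i, (1 - if i ∈ E ∨ t < τ i then (1 : ℝ) else 0) * y i ≤
        ∑ i, (1 - if i ∈ E ∨ t < τ i then (1 : ℝ) else 0) * (t - μ) := by
      refine Finset.sum_le_sum fun i _ => ?_
      split_ifs with hi
      · simp
      · push Not at hi
        have := hτ i hi.1
        linarith [hi.2]
    rw [← Finset.sum_mul, Finset.sum_sub_distrib] at h2
    simp only [Finset.sum_const, Finset.card_univ, Fintype.card_fin, nsmul_eq_mul, mul_one] at h2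
    set sh := ∑ i, (if i ∈ E ∨ t < τ i then (1 : ℝ) else 0)
    have h3 := neg_le_of_abs_le h1
    have h4 : (n : ℝ) / 2 ≤ n - sh := by nlinarith
    nlinarith
  -- the good samples have a small excess
  have hg : ∑ i ∈ Eᶜ, c i * max (τ i - t) 0 ≤ 3 * (D * n) := by
    -- This mass is at most `2εn`, so the good excess is at most `2Dn + 2εn · 10D ≤ 3Dn`.
    set h : Fin n → ℝ := fun i => if i ∉ E ∧ t < τ i then c i else 0 with hh
    have hs : ∑ i, h i ≤ 2 * (ε * n) := by
      refine le_trans ?_ (hcount (Finset.univ.filter fun i => i ∉ E ∧ t < τ i)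
        fun i hi => (Finset.mem_filter.1 hi).2.2)
      rw [← Finset.sum_boole]
      refine Finset.sum_le_sum fun i _ => ?_
      simp only [hh]
      split_ifs <;> simp [hc1]
    have hs0 : 0 ≤ ∑ i, h i := Finset.sum_nonneg fun i _ => by
      simp only [hh]; split_ifs <;> simp [hc0]
    have h1 := hy.abs_sum_le hn hε0.le hε hD (h := h)
      (fun i => by simp only [hh]; split_ifs <;> simp [hc0])
      (fun i => by simp only [hh]; split_ifs <;> simp [hc1]) hs
    have h2 : ∑ i ∈ Eᶜ, c i * max (τ i - t) 0 = ∑ i, (h i * y i - h i * (t - μ)) := by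
      rw [← Finset.sum_add_sum_compl E fun i => (h i * y i - h i * (t - μ)),
        Finset.sum_eq_zero (s := E) fun i hi => by simp [hh, hi], zero_add]
      refine Finset.sum_congr rfl fun i hi => ?_
      have hi := Finset.mem_compl.1 hi
      have := hτ i hi
      simp only [hh, hi, not_false_eq_true, true_and]
      split_ifs with hti
      · rw [max_eq_left (by linarith), this]
        ring
      · rw [max_eq_right (by linarith)]
        simp
    rw [h2, Finset.sum_sub_distrib, ← Finset.sum_mul]
    have h3 := le_of_abs_le h1
    have h4 : -((∑ i, h i) * (t - μ)) ≤ 2 * (ε * n) * (10 * D) := by nlinarith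
    nlinarith
  -- the corrupted samples have a large one
  have hb : ∑ i ∈ E, c i * (τ i - μ) - 2 * (D * n) ≤ ∑ i ∈ E, c i * max (τ i - t) 0 := by
    have h1 : ∑ i ∈ E, (c i * (τ i - μ) - c i * (t - μ)) ≤ ∑ i ∈ E, c i * max (τ i - t) 0 :=
      Finset.sum_le_sum fun i _ => by
        have := mul_le_mul_of_nonneg_left (le_max_left (τ i - t) 0) (hc0 i)
        linarith
    rw [Finset.sum_sub_distrib, ← Finset.sum_mul] at h1
    have h2 : ∑ i ∈ E, c i ≤ ε * n := by
      refine le_trans ?_ hE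
      have := Finset.sum_le_card_nsmul E c 1 fun i _ => hc1 i
      simpa using this
    have h3 : 0 ≤ ∑ i ∈ E, c i := Finset.sum_nonneg fun i _ => hc0 i
    have h4 : (∑ i ∈ E, c i) * (t - μ) ≤ 2 * (D * n) := by
      rcases le_total (t - μ) 0 with h | h
      · nlinarith
      · nlinarith
    linarith
  -- The mass is at least `0.9n`, so the bad excess exceeds `(14 · 0.9 - 1 - 2)Dn = 9.6Dn`, against
  -- at most `3Dn` for the good.
  have hsplit := Finset.sum_add_sum_compl E fun i => c i * (τ i - μ)
  have := le_of_abs_le hgoodmean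
  have hDW : 14 * D * ((1 - 2 * ε) * n) ≤ 14 * D * ∑ i, c i :=
    mul_le_mul_of_nonneg_left hW (by linarith)
  have : 14 * D * (9 / 10 * n) ≤ 14 * D * ((1 - 2 * ε) * n) :=
    mul_le_mul_of_nonneg_left (by nlinarith) (by linarith)
  nlinarith

end Tail

/-! ### Largest entries -/

section Largest

variable {α β : Type*} [Fintype α] [LinearOrder β]

/-- `Q` is an initial segment for `f`. Its last element has fewer than `m` predecessors, which
bounds its size; the first element left out has all its predecessors in `Q`, and at least `m` of
them. -/
theorem exists_largest (f : α → β) (hf : Function.Injective f) (m : ℕ) (Q : Finset α)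
    (hQ : ∀ p, p ∈ Q ↔ (Finset.univ.filter fun q => f q < f p).card < m) :
    Q.card ≤ m ∧ ∀ p, p ∉ Q → m ≤ Q.card ∧ ∀ q ∈ Q, f q < f p := by
  classical
  have hlt : ∀ p, p ∉ Q → ∀ q ∈ Q, f q < f p := fun p hp q hq => by
    by_contra h
    refine hp ((hQ p).2 (lt_of_le_of_lt (Finset.card_le_card fun r hr => ?_) ((hQ q).1 hq)))
    simp only [Finset.mem_filter, Finset.mem_univ, true_and] at hr ⊢
    exact hr.trans_le (not_lt.1 h)
  refine ⟨?_, fun p hp => ⟨?_, hlt p hp⟩⟩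
  · rcases Q.eq_empty_or_nonempty with rfl | hne
    · simp
    · obtain ⟨p, hp, hmax⟩ := Finset.exists_max_image Q f hne
      have h1 : Q ⊆ insert p (Finset.univ.filter fun q => f q < f p) := fun q hq => by
        rcases (hmax q hq).lt_or_eq with h | h
        · simp [h]
        · simp [hf h]
      have h2 := (Finset.card_le_card h1).trans (Finset.card_insert_le _ _)
      have := (hQ p).1 hp
      omega
  · obtain ⟨p₀, hp₀, hmin⟩ := Finset.exists_min_image Qᶜ f ⟨p, Finset.mem_compl.2 hp⟩
    have h1 : (Finset.univ.filter fun q => f q < f p₀) ⊆ Q := fun q hq => by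
      by_contra h
      exact not_lt.2 (hmin q (Finset.mem_compl.2 h)) (Finset.mem_filter.1 hq).2
    refine le_trans ?_ (Finset.card_le_card h1)
    exact not_lt.1 fun h => Finset.mem_compl.1 hp₀ ((hQ p₀).2 h)

end Largest

variable {n d k : ℕ}

theorem truncate_spec (k : ℕ) (A : Fin d → Fin d → ℝ) :
    ∃ Q : Finset (Fin d × Fin d), Q.card ≤ 2 * k ^ 2 ∧
      (∀ j l, (j, l) ∈ Q → truncate k A j l = A j l) ∧
      (∀ j l, (j, l) ∉ Q → truncate k A j l = 0) ∧
      ∀ p, p ∉ Q → 2 * k ^ 2 ≤ Q.card ∧ ∀ q ∈ Q, A p.1 p.2 ^ 2 ≤ A q.1 q.2 ^ 2 := by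
  classical
  -- Breaking ties by position makes the key injective, so that exactly the intended number of
  -- entries survives.
  let f : Fin d × Fin d → ℝ ×ₗ Fin (d * d) :=
    fun p => toLex (-(A p.1 p.2 ^ 2), finProdFinEquiv p)
  have hf : Function.Injective f := fun p q h => by
    have := congrArg (fun z => (ofLex z).2) h
    exact finProdFinEquiv.injective this
  have hB : ∀ p q, Before A p q ↔ f p < f q := fun p q => by
    simp only [f, Prod.Lex.toLex_lt_toLex, Before, neg_lt_neg_iff, neg_inj]
    constructor
    · rintro (h | ⟨h, h'⟩)
      · exact Or.inl h
      · rcases h.lt_or_eq with h | h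
        · exact Or.inl h
        · exact Or.inr ⟨h.symm, h'⟩
    · rintro (h | ⟨h, h'⟩)
      · exact Or.inl h
      · exact Or.inr ⟨h.symm.le, h'⟩
  have hr : ∀ p, entryRank A p = ((Finset.univ.filter fun q => f q < f p).card : ℝ) := fun p => by
    simp only [entryRank, hB]
    rw [← Fintype.sum_prod_type' fun j l => if f (j, l) < f p then (1 : ℝ) else 0,
      Finset.sum_boole]
  let Q := Finset.univ.filter fun p => (Finset.univ.filter fun q => f q < f p).card < 2 * k ^ 2
  have hQ : ∀ p, p ∈ Q ↔ (Finset.univ.filter fun q => f q < f p).card < 2 * k ^ 2 :=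
    fun p => by simp [Q]
  obtain ⟨h1, h2⟩ := exists_largest f hf _ Q hQ
  have ht : ∀ j l, 2 * ((k : ℝ) * k) ≤ entryRank A (j, l) ↔ (j, l) ∉ Q := fun j l => by
    rw [hr, hQ, not_lt, ← pow_two]
    exact_mod_cast Iff.rfl
  refine ⟨Q, h1, fun j l h => ?_, fun j l h => ?_, fun p hp => ⟨(h2 p hp).1, fun q hq => ?_⟩⟩
  · simp only [truncate]
    rw [if_neg (mt (ht j l).1 (not_not.2 h))]
  · simp only [truncate]
    rw [if_pos ((ht j l).2 h)]
  · have := (hB q p).2 ((h2 p hp).2 q hq)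
    rcases this with h | h
    · exact h.le
    · exact h.1

/-! ### The Frobenius inner product -/

/-- The Frobenius inner product. -/
def frobInner (A B : Fin d → Fin d → ℝ) : ℝ := ∑ j, ∑ l, A j l * B j l

theorem sqNorm_nonneg (A : Fin d → Fin d → ℝ) : 0 ≤ sqNorm A :=
  Finset.sum_nonneg fun _ _ => Finset.sum_nonneg fun _ _ => sq_nonneg _

theorem sqNorm_eq_sum (A : Fin d → Fin d → ℝ) : sqNorm A = ∑ p : Fin d × Fin d, A p.1 p.2 ^ 2 :=
  (Fintype.sum_prod_type' fun j l => A j l ^ 2).symm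

theorem frobInner_sq_le (A B : Fin d → Fin d → ℝ) :
    frobInner A B ^ 2 ≤ sqNorm A * sqNorm B := by
  rw [sqNorm_eq_sum, sqNorm_eq_sum, frobInner,
    ← Fintype.sum_prod_type' fun j l => A j l * B j l]
  exact Finset.sum_mul_sq_le_sq_mul_sq _ _ _

theorem abs_frobInner_le (A B : Fin d → Fin d → ℝ) :
    |frobInner A B| ≤ Real.sqrt (sqNorm A) * Real.sqrt (sqNorm B) := by
  rw [← Real.sqrt_mul (sqNorm_nonneg A)]
  exact Real.abs_le_sqrt (frobInner_sq_le A B)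

theorem sq_norm_eq_sqNorm (A : Matrix (Fin d) (Fin d) ℝ) : ‖A‖ ^ 2 = sqNorm A := by
  rw [Matrix.frobenius_norm_def, ← Real.sqrt_eq_rpow, Real.sq_sqrt (by positivity)]
  unfold sqNorm
  simp

theorem sqNorm_outer (v : Fin d → ℝ) :
    sqNorm (fun j l => v j * v l) = (∑ j, v j ^ 2) ^ 2 := by
  simp only [sqNorm, mul_pow]
  rw [pow_two (∑ j, v j ^ 2), Finset.sum_mul_sum]

theorem quadForm_eq_frobInner (B : Fin d → Fin d → ℝ) (x : Fin d → ℝ) :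
    quadForm B x = frobInner B fun j l => x j * x l := by
  simp only [quadForm, frobInner, mul_assoc]

theorem quadForm_outer (v x : Fin d → ℝ) :
    quadForm (fun j l => v j * v l) x = (∑ j, v j * x j) ^ 2 := by
  rw [pow_two, Finset.sum_mul_sum]
  exact Finset.sum_congr rfl fun j _ => Finset.sum_congr rfl fun l _ => by ring

theorem frobInner_comm (A B : Fin d → Fin d → ℝ) : frobInner A B = frobInner B A := by
  simp only [frobInner, mul_comm]

/-! ### Stability -/

variable {ε δ ρ : ℝ} {v : Fin d → ℝ} {G S : Fin n → Fin d → ℝ}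

theorem uniform_mem_weights (hn : 0 < n) (hε0 : 0 ≤ ε) (hε : ε < 1) :
    (fun _ => 1 / (n : ℝ)) ∈ weights n ε := by
  have hn' : (0 : ℝ) < n := by exact_mod_cast hn
  refine ⟨fun i => ⟨by positivity, ?_⟩, ?_⟩
  · exact one_div_le_one_div_of_le (mul_pos (by linarith) hn') (by nlinarith)
  · simp [hn'.ne']

theorem norm_restrictEntries_le {m : ℕ} (A : Matrix (Fin d) (Fin d) ℝ)
    {Q : Finset (Fin d × Fin d)} (hQ : Q.card ≤ m) :
    ‖restrictEntries Q A‖ ≤ sparseFrobNorm m A :=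
  Finset.le_sup' (fun Q => ‖restrictEntries Q A‖) (by simpa using hQ)

theorem IsStable.nonneg (h : IsStable k ε δ ρ v G) (hn : 0 < n) (hε0 : 0 ≤ ε)
    (hε : ε ≤ 1 / 20) : 0 ≤ δ := by
  refine le_trans ?_ (h _ (uniform_mem_weights hn (by linarith) (by linarith)))
  exact (norm_nonneg _).trans (norm_restrictEntries_le (Q := ∅) _ (by simp))

/-- The mean of the quadratic form of `H` under the spiked covariance. -/
def spikedMean (ρ : ℝ) (v : Fin d → ℝ) (H : Fin d → Fin d → ℝ) : ℝ :=
  (∑ j, H j j) + ρ * quadForm H v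

theorem spikedMean_eq (ρ : ℝ) (v : Fin d → ℝ) (H : Fin d → Fin d → ℝ) :
    spikedMean ρ v H = frobInner H (spikedCov ρ v) := by
  simp only [spikedMean, frobInner, spikedCov, Matrix.add_apply, Matrix.smul_apply,
    Matrix.vecMulVec_apply, smul_eq_mul, mul_add, Finset.sum_add_distrib, quadForm, Finset.mul_sum]
  congr 1
  · refine Finset.sum_congr rfl fun j _ => ?_
    simp [Matrix.one_apply]
  · refine Finset.sum_congr rfl fun j _ => Finset.sum_congr rfl fun l _ => by ring

theorem sum_mul_quadForm (c : Fin n → ℝ) (G : Fin n → Fin d → ℝ) (H : Fin d → Fin d → ℝ) :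
    ∑ i, c i * quadForm H (G i) = frobInner H fun j l => ∑ i, c i * G i j * G i l := by
  simp only [quadForm, frobInner, Finset.mul_sum]
  rw [Finset.sum_comm]
  refine Finset.sum_congr rfl fun j _ => ?_
  rw [Finset.sum_comm]
  exact Finset.sum_congr rfl fun l _ => Finset.sum_congr rfl fun i _ => by ring

/-- The centered mean is the Frobenius inner product of `H` with the deviation restricted to `Q`;
stability and Cauchy–Schwarz finish. -/
theorem IsStable.meanBound (h : IsStable k ε δ ρ v G) {H : Fin d → Fin d → ℝ}
    {Q : Finset (Fin d × Fin d)} (hQ : Q.card ≤ 2 * k ^ 2) (hH : ∀ j l, (j, l) ∉ Q → H j l = 0) :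
    MeanBound ε (δ * Real.sqrt (sqNorm H))
      fun i => quadForm H (G i) - spikedMean ρ v H := by
  intro w hw
  have h1 := (norm_restrictEntries_le _ hQ).trans (h w hw)
  have h2 : ∑ i, w i * (quadForm H (G i) - spikedMean ρ v H) =
      frobInner H (restrictEntries Q (secondMoment G w - spikedCov ρ v)) := by
    simp only [mul_sub]
    rw [Finset.sum_sub_distrib, sum_mul_quadForm, ← Finset.sum_mul, hw.2, one_mul, spikedMean_eq]
    unfold frobInner
    rw [← Finset.sum_sub_distrib]
    refine Finset.sum_congr rfl fun j _ => ?_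
    rw [← Finset.sum_sub_distrib]
    refine Finset.sum_congr rfl fun l _ => ?_
    by_cases hp : (j, l) ∈ Q
    · simp [restrictEntries, hp, secondMoment, Matrix.sum_apply, Matrix.vecMulVec_apply, mul_sub,
        mul_assoc]
    · simp [hH j l hp]
  rw [h2, mul_comm]
  refine (abs_frobInner_le _ _).trans (mul_le_mul_of_nonneg_left ?_ (Real.sqrt_nonneg _))
  rw [← sq_norm_eq_sqNorm, Real.sqrt_sq (norm_nonneg _)]
  exact h1

theorem sum_mul_quadForm_centeredMoment (c : Fin n → ℝ) (hc : 0 < ∑ i, c i)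
    (S : Fin n → Fin d → ℝ) (H : Fin d → Fin d → ℝ) :
    ∑ i, c i * quadForm H (S i) =
      (∑ i, c i) * (frobInner H (centeredMoment S c) + ∑ j, H j j) := by
  rw [sum_mul_quadForm, mul_add, frobInner, frobInner, Finset.mul_sum, Finset.mul_sum,
    ← Finset.sum_add_distrib]
  refine Finset.sum_congr rfl fun j _ => ?_
  have h1 : H j j = ∑ l, H j l * if j = l then 1 else 0 := by simp
  rw [h1, Finset.mul_sum, Finset.mul_sum, ← Finset.sum_add_distrib]
  refine Finset.sum_congr rfl fun l _ => ?_
  simp only [centeredMoment]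
  field_simp
  split_ifs <;> ring

/-- Weights bounded by one whose total is almost maximal. -/
def IsAdmissible (ε : ℝ) (c : Fin n → ℝ) : Prop :=
  (∀ i, 0 ≤ c i ∧ c i ≤ 1) ∧ (1 - 2 * ε) * n ≤ ∑ i, c i

theorem IsAdmissible.pos {c : Fin n → ℝ} (hc : IsAdmissible ε c) (hn : 0 < n)
    (hε : ε ≤ 1 / 20) : 0 < ∑ i, c i := by
  have hn' : (0 : ℝ) < n := by exact_mod_cast hn
  exact lt_of_lt_of_le (mul_pos (by linarith) hn') hc.2

theorem quadForm_le_sqrt_sqNorm (hv : ∑ j, v j ^ 2 = 1) (B : Fin d → Fin d → ℝ) :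
    quadForm B v ≤ Real.sqrt (sqNorm B) := by
  rw [quadForm_eq_frobInner]
  refine (le_abs_self _).trans ((abs_frobInner_le _ _).trans ?_)
  rw [sqNorm_outer, hv]
  simp

theorem frobInner_truncate (k : ℕ) (A : Fin d → Fin d → ℝ) :
    frobInner (truncate k A) A = sqNorm (truncate k A) := by
  refine Finset.sum_congr rfl fun j _ => Finset.sum_congr rfl fun l _ => ?_
  simp only [truncate]
  split_ifs <;> ring

/-! ### Analysis of the filter. -/

section Filter

variable {E : Finset (Fin n)}

/-- With `f = ‖B‖_F`, the weighted mean of the centered scores is `f² - ρ vᵀBv ≥ f(f - ρ) > 14δf`,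
and `δf` is exactly the bound `D` for the form `B`. -/
theorem sum_excess_lt_of_sqNorm (hn : 0 < n) (hρ : 0 < ρ) (hε0 : 0 < ε) (hε : ε ≤ 1 / 20)
    (hv : ∑ j, v j ^ 2 = 1) (hG : IsStable k ε δ ρ v G) (hE : (E.card : ℝ) ≤ ε * n)
    (hS : ∀ i, i ∉ E → S i = G i) {c : Fin n → ℝ} (hc0 : ∀ i, 0 ≤ c i) (hc1 : ∀ i, c i ≤ 1)
    (hc : 0 < ∑ i, c i)
    (hgood : ∑ i ∈ Eᶜ, (1 - c i) ≤ ∑ i ∈ E, (1 - c i))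
    (hbig : (ρ + 14 * δ) ^ 2 < sqNorm (truncate k (centeredMoment S c)))
    {τ : Fin n → ℝ} (hτ : τ = fun i => quadForm (truncate k (centeredMoment S c)) (S i)) :
    ∑ i ∈ Eᶜ, c i * max (τ i - threshold ε τ) 0 <
      ∑ i ∈ E, c i * max (τ i - threshold ε τ) 0 := by
  have hδ := hG.nonneg hn hε0.le hε
  set B := truncate k (centeredMoment S c) with hB
  obtain ⟨Q, hQ, -, hQ', -⟩ := truncate_spec k (centeredMoment S c)
  have hf : ρ + 14 * δ < Real.sqrt (sqNorm B) := Real.lt_sqrt_of_sq_lt hbig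
  have hff := Real.mul_self_sqrt (sqNorm_nonneg B)
  set f := Real.sqrt (sqNorm B)
  refine sum_excess_lt (hG.meanBound hQ hQ') hn hε0 hε (mul_nonneg hδ (Real.sqrt_nonneg _)) hE
    (μ := spikedMean ρ v B) (fun i hi => ?_) hc0 hc1 hgood ?_
  · simp only [hτ, hS i hi, ← hB]
    ring
  · have h1 : ∑ i, c i * (τ i - spikedMean ρ v B) = (∑ i, c i) * (f * f - ρ * quadForm B v) := by
      simp only [mul_sub, hτ]
      rw [Finset.sum_sub_distrib, sum_mul_quadForm_centeredMoment c hc, frobInner_truncate,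
        ← Finset.sum_mul, spikedMean, hff]
      ring
    rw [h1, mul_comm _ (∑ i, c i)]
    refine mul_lt_mul_of_pos_left ?_ hc
    have := quadForm_le_sqrt_sqNorm hv B
    nlinarith

theorem card_support_lt {c c' : Fin n → ℝ} (hle : ∀ i, c' i ≤ c i)
    (h : ∃ i, 0 < c i ∧ c' i = 0) :
    (Finset.univ.filter fun i => 0 < c' i).card < (Finset.univ.filter fun i => 0 < c i).card := by
  obtain ⟨i, hi, hi'⟩ := h
  refine Finset.card_lt_card ⟨fun j hj => ?_, fun hsub => ?_⟩
  · simp only [Finset.mem_filter, Finset.mem_univ, true_and] at hj ⊢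
    exact hj.trans_le (hle j)
  · have := hsub (Finset.mem_filter.2 ⟨Finset.mem_univ i, hi⟩)
    simp [hi'] at this

/-- The matrix found by the filter is the truncation of the second moment matrix of admissible
weights, and its norm is hardly larger than that of the spike. -/
theorem robustMatrix_spec (hn : 0 < n) (hρ : 0 < ρ) (hε0 : 0 < ε) (hε : ε ≤ 1 / 20)
    (hv : ∑ j, v j ^ 2 = 1) (hG : IsStable k ε δ ρ v G) (hE : (E.card : ℝ) ≤ ε * n)
    (hS : ∀ i, i ∉ E → S i = G i) :
    ∃ c, IsAdmissible ε c ∧ robustMatrix k ε S = truncate k (centeredMoment S c) ∧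
      sqNorm (robustMatrix k ε S) ≤ (ρ + 14 * δ) ^ 2 := by
  classical
  have hn' : (0 : ℝ) < n := by exact_mod_cast hn
  let s₀ : (Fin n → ℝ) × (Fin d → Fin d → ℝ) :=
    (fun _ => 1, truncate k (centeredMoment S fun _ => 1))
  -- Invariant after `t` rounds: either a matrix of small norm is already stored, or good samples
  -- have lost no more weight than bad ones and at least `t` weights have died.
  have key : ∀ t s, s = (filterStep k ε S)^[t] s₀ →
      (∃ c, IsAdmissible ε c ∧ s.2 = truncate k (centeredMoment S c)) ∧
      (∀ i, 0 ≤ s.1 i ∧ s.1 i ≤ 1) ∧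
      (sqNorm s.2 ≤ (ρ + 14 * δ) ^ 2 ∨
        ∑ i ∈ Eᶜ, (1 - s.1 i) ≤ ∑ i ∈ E, (1 - s.1 i) ∧
        (Finset.univ.filter fun i => 0 < s.1 i).card + t ≤ n) := by
    intro t
    induction t with
    | zero =>
      rintro s rfl
      refine ⟨⟨fun _ => 1, ⟨fun i => by simp, ?_⟩, rfl⟩, fun i => by simp [s₀], Or.inr ⟨?_, ?_⟩⟩
      · simp only [Finset.sum_const, Finset.card_univ, Fintype.card_fin, nsmul_eq_mul, mul_one]
        nlinarith
      · simp [s₀]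
      · simp [s₀]
    | succ t ih =>
      intro s' hs'
      rw [Function.iterate_succ_apply'] at hs'
      obtain ⟨hadm, hbox, hor⟩ := ih _ rfl
      set s := (filterStep k ε S)^[t] s₀
      have h2 : s'.2 = if (1 - 2 * ε) * n ≤ ∑ i, s.1 i ∧
          sqNorm (truncate k (centeredMoment S s.1)) ≤ sqNorm s.2
        then truncate k (centeredMoment S s.1) else s.2 := by rw [hs', filterStep]
      set τ : Fin n → ℝ := fun i => quadForm (truncate k (centeredMoment S s.1)) (S i) with hτ
      have h1 : s'.1 = reweight ε s.1 τ := by rw [hs', filterStep]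
      obtain ⟨hr1, ⟨r, hr0, hr⟩, hr3⟩ := reweight_spec ε (fun i => (hbox i).1) τ
      rw [← h1] at hr1 hr hr3
      refine ⟨?_, fun i => ⟨(hr1 i).1, (hr1 i).2.trans (hbox i).2⟩, ?_⟩
      · rw [h2]
        split_ifs with h
        · exact ⟨s.1, ⟨hbox, h.1⟩, rfl⟩
        · exact hadm
      · have hmono : sqNorm s'.2 ≤ sqNorm s.2 := by
          rw [h2]
          split_ifs with h
          · exact h.2
          · exact le_rfl
        rcases hor with hor | ⟨hgood, hcard⟩
        · exact Or.inl (hmono.trans hor)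
        · have hW : (1 - 2 * ε) * n ≤ ∑ i, s.1 i := by
            have h1 : ∑ i, (1 - s.1 i) = n - ∑ i, s.1 i := by simp
            have h2 := Finset.sum_add_sum_compl E fun i => 1 - s.1 i
            have h3 : ∑ i ∈ E, (1 - s.1 i) ≤ ε * n := by
              refine le_trans ?_ hE
              have := Finset.sum_le_card_nsmul E (fun i => 1 - s.1 i) 1
                fun i _ => by linarith [(hbox i).1]
              simpa using this
            linarith
          by_cases hbig : (ρ + 14 * δ) ^ 2 < sqNorm (truncate k (centeredMoment S s.1))
          · right
            have hlt := sum_excess_lt_of_sqNorm hn hρ hε0 hε hv hG hE hS (fun i => (hbox i).1)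
              (fun i => (hbox i).2) (IsAdmissible.pos ⟨hbox, hW⟩ hn hε) hgood hbig hτ
            constructor
            · have hdec : ∀ F : Finset (Fin n), ∑ i ∈ F, (1 - s'.1 i) =
                  ∑ i ∈ F, (1 - s.1 i) + r * ∑ i ∈ F, s.1 i * max (τ i - threshold ε τ) 0 := by
                intro F
                rw [Finset.mul_sum, ← Finset.sum_add_distrib]
                exact Finset.sum_congr rfl fun i _ => by rw [← hr i]; ring
              rw [hdec, hdec]
              exact add_le_add hgood (mul_le_mul_of_nonneg_left hlt.le hr0)
            · have hex : ∃ i, 0 < s.1 i ∧ threshold ε τ < τ i := by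
                have h0 : 0 < ∑ i ∈ E, s.1 i * max (τ i - threshold ε τ) 0 :=
                  lt_of_le_of_lt (Finset.sum_nonneg fun i _ =>
                    mul_nonneg (hbox i).1 (le_max_right _ _)) hlt
                obtain ⟨i, -, hi⟩ := Finset.exists_lt_of_sum_lt (s := E) (f := fun _ => (0 : ℝ))
                  (by simpa using h0)
                refine ⟨i, (hbox i).1.lt_of_ne fun h => ?_, ?_⟩
                · simp [← h] at hi
                · by_contra h
                  rw [max_eq_right (by linarith)] at hi
                  simp at hi
              have := card_support_lt (fun i => (hr1 i).2) (hr3 hex)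
              omega
          · left
            rw [h2]
            split_ifs with h
            · exact not_lt.1 hbig
            -- The weights are admissible, so a rejected candidate means that the stored matrix is
            -- smaller still.
            · have h := not_le.1 fun h' => h ⟨hW, h'⟩
              exact h.le.trans (not_lt.1 hbig)
  obtain ⟨⟨c, hc, hc'⟩, hbox, hor⟩ := key n _ rfl
  have hrob : robustMatrix k ε S = ((filterStep k ε S)^[n] s₀).2 := by
    rw [robustMatrix, foldl_const_eq_iterate]
  rw [← hrob] at hc' hor
  -- After `n` rounds the second alternative leaves no weight at all, so there would be no more good
  -- samples than bad, contradicting `ε ≤ 1/20`.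
  refine ⟨c, hc, hc', hor.resolve_right fun ⟨hgood, hcard⟩ => ?_⟩
  set s := (filterStep k ε S)^[n] s₀
  have h0 : ∀ i, s.1 i = 0 := fun i => by
    have : (Finset.univ.filter fun i => 0 < s.1 i).card = 0 := by omega
    rw [Finset.card_eq_zero, Finset.filter_eq_empty_iff] at this
    exact le_antisymm (not_lt.1 (this (Finset.mem_univ i))) (hbox i).1
  have h1 := Finset.card_add_card_compl E
  simp only [h0, sub_zero, Finset.sum_const, nsmul_eq_mul, mul_one] at hgood
  rw [Fintype.card_fin] at h1
  have h2 : (E.card : ℝ) + Eᶜ.card = n := by exact_mod_cast h1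
  nlinarith

/-- The spike is seen by all admissible weights. -/
theorem le_quadForm_centeredMoment (hn : 0 < n) (hρ : 0 < ρ) (hρ1 : ρ ≤ 1) (hε0 : 0 < ε)
    (hε : ε ≤ 1 / 20) (hv : IsSparseUnit k v) (hG : IsStable k ε δ ρ v G)
    (hE : (E.card : ℝ) ≤ ε * n) (hS : ∀ i, i ∉ E → S i = G i) {c : Fin n → ℝ}
    (hc : IsAdmissible ε c) :
    ρ - 4 * ε - 10 * δ ≤ quadForm (centeredMoment S c) v := by
  classical
  have hn' : (0 : ℝ) < n := by exact_mod_cast hn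
  have hδ := hG.nonneg hn hε0.le hε
  have hW := hc.pos hn hε
  set W := ∑ i, c i
  set H : Fin d → Fin d → ℝ := fun j l => v j * v l
  set R := Finset.univ.filter fun j => v j ≠ 0
  have hR : R.card ≤ k := by
    have := hv.2
    rwa [Set.ncard_eq_toFinset_card', Set.toFinset_ofPred] at this
  have hQ : (R ×ˢ R).card ≤ 2 * k ^ 2 := by
    rw [Finset.card_product]
    nlinarith [Nat.mul_le_mul hR hR]
  have hH : ∀ j l, (j, l) ∉ R ×ˢ R → H j l = 0 := fun j l h => by
    by_contra h'
    exact h (by simpa [R, H] using h')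
  have hHnorm : sqNorm H = 1 := by rw [sqNorm_outer, hv.1]; norm_num
  have hy := hG.meanBound hQ hH
  rw [hHnorm, Real.sqrt_one, mul_one] at hy
  have hμ : spikedMean ρ v H = 1 + ρ := by
    rw [spikedMean, quadForm_outer]
    simp only [H, ← pow_two, hv.1]
    ring
  rw [hμ] at hy
  have hcE : ∑ i ∈ E, c i ≤ ε * n := by
    refine le_trans ?_ hE
    have := Finset.sum_le_card_nsmul E c 1 fun i _ => (hc.1 i).2
    simpa using this
  -- The deleted mass is at most `εn` on `E` plus `2εn` off it, whence the version for `4εn`.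
  have h1 := hy.abs_sum_one_sub_le' hn hε0.le hε hδ (h := fun i => if i ∈ E then 1 else 1 - c i)
    (fun i => by split_ifs <;> linarith [(hc.1 i).2])
    (fun i => by split_ifs <;> linarith [(hc.1 i).1]) ?_
  · have h2 : ∑ i, (1 - if i ∈ E then 1 else 1 - c i) * (quadForm H (G i) - (1 + ρ)) =
        ∑ i ∈ Eᶜ, c i * quadForm H (S i) - (∑ i ∈ Eᶜ, c i) * (1 + ρ) := by
      rw [← Finset.sum_add_sum_compl E, Finset.sum_eq_zero (s := E) fun i hi => by simp [hi],
        zero_add, Finset.sum_mul, ← Finset.sum_sub_distrib]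
      refine Finset.sum_congr rfl fun i hi => ?_
      have hi := Finset.mem_compl.1 hi
      rw [hS i hi, if_neg hi]
      ring
    rw [h2] at h1
    -- Corrupted samples contribute squares `⟨v, S i⟩²`, so dropping them only costs their mass
    -- times `1 + ρ ≤ 2`.
    have h3 : 0 ≤ ∑ i ∈ E, c i * quadForm H (S i) := Finset.sum_nonneg fun i _ =>
      mul_nonneg (hc.1 i).1 (by rw [quadForm_outer]; positivity)
    have h4 := Finset.sum_add_sum_compl E fun i => c i * quadForm H (S i)
    have h5 : ∑ i ∈ E, c i + ∑ i ∈ Eᶜ, c i = W := Finset.sum_add_sum_compl E c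
    have h6 := sum_mul_quadForm_centeredMoment c hW S H
    have h7 : frobInner H (centeredMoment S c) = quadForm (centeredMoment S c) v := by
      rw [frobInner_comm, quadForm_eq_frobInner]
    have h8 : ∑ j, H j j = 1 := by simp only [H, ← pow_two, hv.1]
    rw [h7, h8] at h6
    have h9 := neg_le_of_abs_le h1
    have h10 : (n : ℝ) ≤ 2 * W := by nlinarith [hc.2]
    have h11 : W * (ρ - 4 * ε - 10 * δ) ≤ W * quadForm (centeredMoment S c) v := by
      have a1 : (∑ i ∈ E, c i) * (1 + ρ) ≤ 2 * (ε * n) := by nlinarith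
      have a2 : ε * n ≤ ε * (2 * W) := mul_le_mul_of_nonneg_left h10 hε0.le
      have a3 : δ * n ≤ δ * (2 * W) := mul_le_mul_of_nonneg_left h10 hδ
      have a4 : (∑ i ∈ Eᶜ, c i) * (1 + ρ) = W * (1 + ρ) - (∑ i ∈ E, c i) * (1 + ρ) := by
        rw [← h5]; ring
      nlinarith
    exact le_of_mul_le_mul_left h11 hW
  · rw [← Finset.sum_add_sum_compl E, Finset.sum_congr rfl fun i hi => if_pos hi,
      Finset.sum_congr (s₁ := Eᶜ) rfl fun i hi => if_neg (Finset.mem_compl.1 hi)]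
    have h1 : ∑ i, (1 - c i) = n - W := by simp [W]
    have h2 := Finset.sum_add_sum_compl E fun i => 1 - c i
    have h3 : 0 ≤ ∑ i ∈ E, (1 - c i) := Finset.sum_nonneg fun i _ => by linarith [(hc.1 i).2]
    simp only [Finset.sum_const, nsmul_eq_mul, mul_one]
    have := hc.2
    have : 0 ≤ ε * n := by positivity
    linarith

end Filter

/-! ### Stability of samples bounds the contamination -/

/-- Put `h = 2ε` on the indices of one sign of `y`, then on those of the other, and combine. -/
theorem MeanBound.sum_abs_le {D : ℝ} {y : Fin n → ℝ} (hy : MeanBound ε D y) (hn : 0 < n)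
    (hε0 : 0 ≤ ε) (hε : ε ≤ 1 / 20) (hD : 0 ≤ D) : ε * ∑ i, |y i| ≤ 2 * (D * n) := by
  have hle : ∀ (P : Fin n → Prop) [DecidablePred P],
      |∑ i, (if P i then 2 * ε else 0) * y i| ≤ 2 * (D * n) :=
    fun P _ => hy.abs_sum_le hn hε0 hε hD (fun i => by split_ifs <;> linarith)
      (fun i => by split_ifs <;> linarith) (by
        refine (Finset.sum_le_card_nsmul _ _ (2 * ε) fun i _ => by split_ifs <;> linarith).trans ?_
        simp only [Finset.card_univ, Fintype.card_fin, nsmul_eq_mul]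
        linarith)
  have h1 := le_of_abs_le (hle fun i => 0 ≤ y i)
  have h2 := neg_le_of_abs_le (hle fun i => ¬ 0 ≤ y i)
  have h3 : 2 * (ε * ∑ i, |y i|) = ∑ i, (if 0 ≤ y i then 2 * ε else 0) * y i -
      ∑ i, (if ¬ 0 ≤ y i then 2 * ε else 0) * y i := by
    rw [Finset.mul_sum, Finset.mul_sum, ← Finset.sum_sub_distrib]
    refine Finset.sum_congr rfl fun i _ => ?_
    by_cases h : 0 ≤ y i
    · simp only [h, if_true, not_true_eq_false, if_false, abs_of_nonneg h]
      ring
    · simp only [h, if_false, not_false_eq_true, if_true, abs_of_neg (not_le.1 h)]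
      ring
  linarith

theorem IsStable.meanBound_entry (hG : IsStable k ε δ ρ v G) (hk : 0 < k) (j l : Fin d) :
    MeanBound ε δ fun i => G i j * G i l - ((if j = l then 1 else 0) + ρ * (v j * v l)) := by
  classical
  let H : Fin d → Fin d → ℝ := fun a b => if a = j then if b = l then 1 else 0 else 0
  have hq : ∀ x, quadForm H x = x j * x l := fun x => by
    simp only [quadForm, H]
    rw [Finset.sum_eq_single j (by intro b _ hb; simp [hb]) (by simp),
      Finset.sum_eq_single l (by intro b _ hb; simp [hb]) (by simp)]
    simp
  have hs : sqNorm H = 1 := by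
    simp only [sqNorm, H]
    rw [Finset.sum_eq_single j (by intro b _ hb; simp [hb]) (by simp),
      Finset.sum_eq_single l (by intro b _ hb; simp [hb]) (by simp)]
    simp
  have hm : spikedMean ρ v H = (if j = l then 1 else 0) + ρ * (v j * v l) := by
    rw [spikedMean, hq]
    simp only [H]
    rw [Finset.sum_eq_single j (by intro b _ hb; simp [hb]) (by simp)]
    simp
  have := hG.meanBound (H := H) (Q := {(j, l)}) (by simp; nlinarith) fun a b hab => by
    simp only [H]
    split_ifs with h1 h2
    · exact absurd (by simp [h1, h2]) hab
    · rfl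
    · rfl
  simpa only [hs, hq, hm, Real.sqrt_one, mul_one] using this

/-- Were `δ` much smaller than `ε`, some single sample would nearly match the covariance on the
coordinates `j, l`; but `xxᵀ` has vanishing `2 × 2` minors while the covariance minor is at least 1.
-/
theorem IsStable.eps_le (hG : IsStable k ε δ ρ v G) (hk : 0 < k) (hn : 0 < n) (hε0 : 0 ≤ ε)
    (hε : ε ≤ 1 / 20) (hρ0 : 0 ≤ ρ) {j l : Fin d} (hjl : j ≠ l) : ε ≤ 60 * δ := by
  have hn' : (0 : ℝ) < n := by exact_mod_cast hn
  have hδ := hG.nonneg hn hε0 hε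
  by_contra hcon
  push Not at hcon
  have h1 := (hG.meanBound_entry hk j j).sum_abs_le hn hε0 hε hδ
  have h2 := (hG.meanBound_entry hk l l).sum_abs_le hn hε0 hε hδ
  have h3 := (hG.meanBound_entry hk j l).sum_abs_le hn hε0 hε hδ
  simp only [if_true, if_neg hjl, zero_add] at h1 h2 h3
  -- The three deviations sum to at most `6δn/ε < n/10` over all samples, which is where 60 comes
  -- from.
  have hex : ∃ i, |G i j * G i j - (1 + ρ * (v j * v j))| +
      |G i l * G i l - (1 + ρ * (v l * v l))| + |G i j * G i l - ρ * (v j * v l)| < 1 / 10 := by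
    by_contra hall
    push Not at hall
    have := Finset.sum_le_sum fun i (_ : i ∈ Finset.univ) => hall i
    simp only [Finset.sum_add_distrib, Finset.sum_const, Finset.card_univ, Fintype.card_fin,
      nsmul_eq_mul] at this
    have h4 := mul_le_mul_of_nonneg_left this hε0
    have h5 : 60 * δ * n < ε * n := mul_lt_mul_of_pos_right hcon hn'
    nlinarith
  obtain ⟨i, hi⟩ := hex
  set a := G i j
  set b := G i l
  set s := ρ * (v j * v j)
  set t := ρ * (v l * v l)
  set r := ρ * (v j * v l)
  have hs : 0 ≤ s := mul_nonneg hρ0 (mul_self_nonneg _)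
  have ht : 0 ≤ t := mul_nonneg hρ0 (mul_self_nonneg _)
  have hr : r ^ 2 = s * t := by simp only [r, s, t]; ring
  have hr1 : 2 * r ≤ s + t := by
    have := mul_nonneg hρ0 (sq_nonneg (v j - v l))
    simp only [r, s, t]; linarith
  have hr2 : -(2 * r) ≤ s + t := by
    have := mul_nonneg hρ0 (sq_nonneg (v j + v l))
    simp only [r, s, t]; linarith
  have p1 := abs_nonneg (a * a - (1 + s))
  have p2 := abs_nonneg (b * b - (1 + t))
  have p3 := abs_nonneg (a * b - r)
  have q1 : 9 / 10 + s ≤ a * a := by linarith [neg_le_abs (a * a - (1 + s))]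
  have q2 : 9 / 10 + t ≤ b * b := by linarith [neg_le_abs (b * b - (1 + t))]
  have q3 : (a * b - r) ^ 2 ≤ (1 / 10) ^ 2 := sq_le_sq' (by linarith [neg_le_abs (a * b - r)])
    (by linarith [le_abs_self (a * b - r)])
  have q4 : (9 / 10 + s) * (9 / 10 + t) ≤ (a * a) * (b * b) :=
    mul_le_mul q1 q2 (by linarith) (mul_self_nonneg a)
  have q5 : r * (a * b - r) ≤ (s + t) / 2 * (1 / 10) := by
    have e1 : |a * b - r| ≤ 1 / 10 := by linarith
    have e2 : |r| ≤ (s + t) / 2 := abs_le.2 ⟨by linarith, by linarith⟩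
    refine (le_abs_self _).trans ?_
    rw [abs_mul]
    exact mul_le_mul e2 e1 (abs_nonneg _) (by linarith)
  -- Expanding `(ab)²` about `r`: `(9/10 + s)(9/10 + t) ≤ st + (s + t)/10 + 1/100`, which is false
  -- for `s, t ≥ 0`.
  nlinarith

/-! ### The truncated matrix is close to the spike -/

theorem sqNorm_sub_mul (A B : Fin d → Fin d → ℝ) (r : ℝ) :
    sqNorm (fun j l => A j l - r * B j l) =
      sqNorm A - 2 * r * frobInner A B + r ^ 2 * sqNorm B := by
  simp only [sqNorm, frobInner, Finset.mul_sum]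
  rw [← Finset.sum_sub_distrib, ← Finset.sum_add_distrib]
  refine Finset.sum_congr rfl fun j _ => ?_
  rw [← Finset.sum_sub_distrib, ← Finset.sum_add_distrib]
  exact Finset.sum_congr rfl fun l _ => by ring

theorem sqNorm_sub_le (A B C : Fin d → Fin d → ℝ) :
    sqNorm (fun j l => A j l - C j l) ≤
      2 * sqNorm (fun j l => A j l - B j l) + 2 * sqNorm fun j l => B j l - C j l := by
  simp only [sqNorm, Finset.mul_sum]
  rw [← Finset.sum_add_distrib]
  refine Finset.sum_le_sum fun j _ => ?_
  rw [← Finset.sum_add_distrib]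
  refine Finset.sum_le_sum fun l _ => ?_
  nlinarith [sq_nonneg (A j l - B j l - (B j l - C j l))]

section Sets

variable {ι : Type*} [DecidableEq ι]

/-- If `Q` misses an element of `R`, then `Q` has at least `2m` elements, so `Q \ R` is at least
twice as large as `R \ Q`, and each of its values dominates. This is why twice `k²` entries are
kept. -/
theorem two_mul_sum_sdiff_le {Q R : Finset ι} {g : ι → ℝ} (hg : ∀ p, 0 ≤ g p) {m : ℕ}
    (hR : R.card ≤ m) (hQ : ∀ p, p ∉ Q → 2 * m ≤ Q.card ∧ ∀ q ∈ Q, g p ≤ g q) :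
    2 * ∑ p ∈ R \ Q, g p ≤ ∑ p ∈ Q \ R, g p := by
  rcases (R \ Q).eq_empty_or_nonempty with h | h
  · rw [h, Finset.sum_empty, mul_zero]
    exact Finset.sum_nonneg fun p _ => hg p
  · obtain ⟨p₀, hp₀, hmax⟩ := Finset.exists_max_image _ g h
    obtain ⟨h1, h2⟩ := hQ p₀ (Finset.mem_sdiff.1 hp₀).2
    have h3 := Finset.sum_le_card_nsmul (R \ Q) g (g p₀) hmax
    have h4 := Finset.card_nsmul_le_sum (Q \ R) g (g p₀)
      fun q hq => h2 q (Finset.mem_sdiff.1 hq).1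
    have h5 := Finset.card_sdiff_add_card_inter R Q
    have h6 := Finset.card_sdiff_add_card_inter Q R
    rw [Finset.inter_comm] at h6
    have h7 : 2 * (R \ Q).card ≤ (Q \ R).card := by omega
    have h8 : (2 : ℝ) * (R \ Q).card ≤ (Q \ R).card := by exact_mod_cast h7
    rw [nsmul_eq_mul] at h3 h4
    nlinarith [mul_le_mul_of_nonneg_right h8 (hg p₀)]

end Sets

theorem sqNorm_truncate_sub_le (hv : IsSparseUnit k v) {A : Fin d → Fin d → ℝ} {α : ℝ}
    (hα0 : 0 ≤ α) (hα : α ≤ ρ) (hA : sqNorm (truncate k A) ≤ (ρ + α) ^ 2)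
    (hq : ρ - α ≤ quadForm A v) :
    sqNorm (fun j l => truncate k A j l - ρ * (v j * v l)) ≤ 26 * (ρ * α) := by
  classical
  obtain ⟨Q, hQ, hQ1, hQ0, hQl⟩ := truncate_spec k A
  set B := truncate k A
  set R₀ := Finset.univ.filter fun j => v j ≠ 0
  have hR₀ : R₀.card ≤ k := by
    have := hv.2
    rwa [Set.ncard_eq_toFinset_card', Set.toFinset_ofPred] at this
  set R := R₀ ×ˢ R₀
  have hR : R.card ≤ k ^ 2 := by
    rw [Finset.card_product, pow_two]
    exact Nat.mul_le_mul hR₀ hR₀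
  set a : Fin d × Fin d → ℝ := fun p => A p.1 p.2
  set V : Fin d × Fin d → ℝ := fun p => v p.1 * v p.2
  have hV : ∀ p, p ∉ R → V p = 0 := fun p h => by
    by_contra h'
    exact h (by simpa [R, R₀, V] using h')
  have hBa : ∀ p, B p.1 p.2 = if p ∈ Q then a p else 0 := fun p => by
    split_ifs with h
    · exact hQ1 _ _ h
    · exact hQ0 _ _ h
  have hsB : sqNorm B = ∑ p ∈ Q, a p ^ 2 := by
    rw [sqNorm_eq_sum, ← Finset.sum_filter_add_sum_filter_not Finset.univ (fun p => p ∈ Q),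
      Finset.filter_mem_eq_inter, Finset.univ_inter, Finset.sum_eq_zero (s := Finset.filter _ _),
      add_zero]
    · exact Finset.sum_congr rfl fun p hp => by rw [hBa, if_pos hp]
    · intro p hp
      rw [hBa, if_neg (Finset.mem_filter.1 hp).2]
      simp
  have hVsum : ∑ p ∈ R, V p ^ 2 = 1 := by
    rw [Finset.sum_subset (Finset.subset_univ R) fun p _ hp => by simp [hV p hp]]
    have := sqNorm_outer v
    rwa [sqNorm_eq_sum, hv.1, one_pow] at this
  have hqf : quadForm A v = ∑ p ∈ R, a p * V p := by
    rw [Finset.sum_subset (Finset.subset_univ R) fun p _ hp => by simp [hV p hp],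
      quadForm_eq_frobInner, frobInner,
      ← Fintype.sum_prod_type' fun j l => A j l * (v j * v l)]
  have hRle : (ρ - α) ^ 2 ≤ ∑ p ∈ R, a p ^ 2 := by
    have h1 := Finset.sum_mul_sq_le_sq_mul_sq R a V
    rw [hVsum, mul_one, ← hqf] at h1
    exact (pow_le_pow_left₀ (by linarith) hq 2).trans h1
  have hsd := two_mul_sum_sdiff_le (g := fun p => a p ^ 2) (fun p => sq_nonneg _) hR hQl
  have h1 : ∑ p ∈ R \ Q, a p ^ 2 + ∑ p ∈ R ∩ Q, a p ^ 2 = ∑ p ∈ R, a p ^ 2 := by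
    rw [add_comm]; exact Finset.sum_inter_add_sum_sdiff R Q _
  have h2 : ∑ p ∈ Q \ R, a p ^ 2 + ∑ p ∈ R ∩ Q, a p ^ 2 = ∑ p ∈ Q, a p ^ 2 := by
    rw [add_comm, Finset.inter_comm]; exact Finset.sum_inter_add_sum_sdiff Q R _
  -- By `hsd` the missed mass is at most the mass of `Q` minus that of `R`, hence at most `(ρ + α)²
  -- - (ρ - α)²`.
  have hrest : ∑ p ∈ R \ Q, a p ^ 2 ≤ 4 * (ρ * α) := by nlinarith
  have h3 : sqNorm (fun j l => B j l - ρ * (v j * v l)) ≤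
      ∑ p, (2 * (if p ∈ R ∪ Q then (a p - ρ * V p) ^ 2 else 0) +
        2 * if p ∈ R \ Q then a p ^ 2 else 0) := by
    rw [sqNorm_eq_sum]
    refine Finset.sum_le_sum fun p _ => ?_
    change (B p.1 p.2 - ρ * V p) ^ 2 ≤ _
    rw [hBa]
    by_cases hp : p ∈ Q
    · simp only [hp, if_true, Finset.mem_union, or_true, Finset.mem_sdiff, not_true_eq_false,
        and_false, if_false]
      nlinarith [sq_nonneg (a p - ρ * V p)]
    · by_cases hp' : p ∈ R
      · simp only [hp, hp', if_false, Finset.mem_union, true_or, if_true, Finset.mem_sdiff,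
          not_false_eq_true, and_true]
        nlinarith [sq_nonneg (a p - ρ * V p + a p)]
      · simp [hp, hp', hV p hp']
  have h4 : ∑ p ∈ R ∪ Q, (a p - ρ * V p) ^ 2 =
      ∑ p ∈ Q, a p ^ 2 + ∑ p ∈ R \ Q, a p ^ 2 - 2 * ρ * quadForm A v + ρ ^ 2 := by
    have e1 : ∑ p ∈ R ∪ Q, a p ^ 2 = ∑ p ∈ Q, a p ^ 2 + ∑ p ∈ R \ Q, a p ^ 2 := by
      rw [← Finset.sdiff_union_self_eq_union, Finset.sum_union Finset.sdiff_disjoint, add_comm]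
    have e2 : ∑ p ∈ R ∪ Q, a p * V p = quadForm A v := by
      rw [hqf]
      exact (Finset.sum_subset Finset.subset_union_left fun p _ hp => by simp [hV p hp]).symm
    have e3 : ∑ p ∈ R ∪ Q, V p ^ 2 = 1 := by
      rw [← hVsum]
      exact (Finset.sum_subset Finset.subset_union_left fun p _ hp => by simp [hV p hp]).symm
    have e4 : ∑ p ∈ R ∪ Q, (a p - ρ * V p) ^ 2 = ∑ p ∈ R ∪ Q, a p ^ 2 -
        2 * ρ * ∑ p ∈ R ∪ Q, a p * V p + ρ ^ 2 * ∑ p ∈ R ∪ Q, V p ^ 2 := by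
      rw [Finset.mul_sum, Finset.mul_sum, ← Finset.sum_sub_distrib, ← Finset.sum_add_distrib]
      exact Finset.sum_congr rfl fun p _ => by ring
    rw [e4, e1, e2, e3, mul_one]
  rw [Finset.sum_add_distrib, ← Finset.mul_sum, ← Finset.mul_sum, Finset.sum_ite_mem,
    Finset.sum_ite_mem, Finset.univ_inter, Finset.univ_inter, h4] at h3
  rw [hsB] at hA
  -- On `R ∪ Q` the squared error is at most `8ρα + α² ≤ 9ρα`, and `2 · 9 + 2 · 4 = 26`.
  nlinarith

/-! ### The best normalized column -/

/-- The strict inequality in the last clause later excludes zero columns. -/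
theorem foldl_best_spec {α : Type*} (φ : α → ℝ) {m : ℕ} (g : Fin m → α) (u₀ : α)
    [∀ a b, Decidable (φ a ≤ φ b)] :
    let r := Fin.foldl m (fun u j => if φ (g j) ≤ φ u then u else g j) u₀
    φ u₀ ≤ φ r ∧ (∀ j, φ (g j) ≤ φ r) ∧ (r = u₀ ∨ ∃ j, r = g j ∧ φ u₀ < φ r) := by
  induction m with
  | zero => simp
  | succ m ih =>
    obtain ⟨h1, h2, h3⟩ := ih fun j => g j.castSucc
    rw [Fin.foldl_succ_last]
    set r := Fin.foldl m (fun u j => if φ (g j.castSucc) ≤ φ u then u else g j.castSucc) u₀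
    dsimp only
    split_ifs with h
    · exact ⟨h1, fun j => Fin.lastCases h h2 j, h3.imp_right fun ⟨j, hj⟩ => ⟨_, hj⟩⟩
    · have h := not_le.1 h
      exact ⟨h1.trans h.le, fun j => Fin.lastCases le_rfl (fun j => (h2 j).trans h.le) j,
        Or.inr ⟨_, rfl, h1.trans_lt h⟩⟩

theorem sum_sq_direction (B : Fin d → Fin d → ℝ) (j : Fin d) (h : 0 < ∑ l, B l j ^ 2) :
    ∑ l, direction B j l ^ 2 = 1 := by
  simp only [direction, div_pow, Real.sq_sqrt h.le]
  rw [← Finset.sum_div, div_self h.ne']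

theorem principalDirection_spec (hd : 0 < d) (B : Fin d → Fin d → ℝ) :
    ∑ l, principalDirection B l ^ 2 = 1 ∧
      ∀ j, quadForm B (direction B j) ^ 2 ≤ quadForm B (principalDirection B) ^ 2 := by
  obtain ⟨-, h2, h3⟩ := foldl_best_spec (fun u => quadForm B u ^ 2) (direction B)
    (fun l : Fin d => if (l : ℕ) ≤ 0 then (1 : ℝ) else 0)
  change ∀ j, _ ≤ quadForm B (principalDirection B) ^ 2 at h2
  change principalDirection B = _ ∨ ∃ j, principalDirection B = _ ∧
    _ < quadForm B (principalDirection B) ^ 2 at h3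
  refine ⟨?_, h2⟩
  rcases h3 with h3 | ⟨j, hj, hpos⟩
  · rw [h3, Finset.sum_eq_single (⟨0, hd⟩ : Fin d)]
    · simp
    · intro l _ hl
      have : (l : ℕ) ≠ 0 := fun h => hl (Fin.ext h)
      simp [this]
    · simp
  -- A zero column is "normalized" to the zero vector by division by zero; its form is 0 and cannot
  -- strictly beat the initial unit vector.
  · replace hpos := (sq_nonneg _).trans_lt hpos
    rw [hj] at hpos ⊢
    refine sum_sq_direction B j ?_
    refine (Finset.sum_nonneg fun l _ => sq_nonneg _).lt_of_ne fun h => ?_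
    have : direction B j = 0 := by
      funext l
      simp [direction, ← h]
    rw [this] at hpos
    simp [quadForm] at hpos

theorem sqNorm_outer_sub {u : Fin d → ℝ} (hu : ∑ j, u j ^ 2 = 1) (hv : ∑ j, v j ^ 2 = 1)
    (r : ℝ) : sqNorm (fun j l => u j * u l - r * (v j * v l)) =
      1 - 2 * r * (∑ j, u j * v j) ^ 2 + r ^ 2 := by
  rw [sqNorm_sub_mul, sqNorm_outer, sqNorm_outer, hu, hv, ← quadForm_outer, quadForm_eq_frobInner]
  ring

theorem inner_sq_le_one {u : Fin d → ℝ} (hu : ∑ j, u j ^ 2 = 1) (hv : ∑ j, v j ^ 2 = 1) :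
    (∑ j, u j * v j) ^ 2 ≤ 1 := by
  have := Finset.sum_mul_sq_le_sq_mul_sq Finset.univ u v
  rwa [hu, hv, one_mul] at this

/-- Some normalized column of a matrix close to a spike is close to the spike. -/
theorem exists_direction (hv : ∑ j, v j ^ 2 = 1) (hρ : 0 < ρ) {B : Fin d → Fin d → ℝ} {K : ℝ}
    (hK : K < ρ ^ 2) (hB : sqNorm (fun j l => B j l - ρ * (v j * v l)) ≤ K) :
    ∃ j, ∑ l, direction B j l ^ 2 = 1 ∧
      1 - K / ρ ^ 2 ≤ (∑ l, direction B j l * v l) ^ 2 := by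
  -- Averaging over columns: the total error `K` equals `∑ j, K * v j ^ 2`.
  have hex : ∃ j, v j ≠ 0 ∧ ∑ l, (B l j - ρ * (v l * v j)) ^ 2 ≤ K * v j ^ 2 := by
    by_contra hall
    push Not at hall
    have hne : ∃ j, v j ≠ 0 := by
      by_contra h
      push Not at h
      simp [h] at hv
    obtain ⟨j₀, hj₀⟩ := hne
    have h1 : ∑ j, K * v j ^ 2 < ∑ j, ∑ l, (B l j - ρ * (v l * v j)) ^ 2 := by
      refine Finset.sum_lt_sum (fun j _ => ?_) ⟨j₀, Finset.mem_univ _, hall j₀ hj₀⟩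
      by_cases h : v j = 0
      · rw [h]
        simp only [ne_eq, OfNat.ofNat_ne_zero, not_false_eq_true, zero_pow, mul_zero]
        exact Finset.sum_nonneg fun l _ => sq_nonneg _
      · exact (hall j h).le
    rw [← Finset.mul_sum, hv, mul_one, Finset.sum_comm] at h1
    exact absurd hB (not_le.2 h1)
  obtain ⟨j, hj, hle⟩ := hex
  have hj2 : 0 < v j ^ 2 := by positivity
  set N := ∑ l, B l j ^ 2 with hN
  set m := ∑ l, B l j * v l with hm
  set r := ρ * v j
  have hexp : ∑ l, (B l j - ρ * (v l * v j)) ^ 2 = N - 2 * r * m + r ^ 2 := by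
    have : ∀ l, (B l j - ρ * (v l * v j)) ^ 2 =
        B l j ^ 2 - 2 * r * (B l j * v l) + r ^ 2 * v l ^ 2 := fun l => by
      simp only [r]; ring
    simp only [this, Finset.sum_add_distrib, Finset.sum_sub_distrib, ← Finset.mul_sum, hv]
    ring
  rw [hexp] at hle
  have hr2 : r ^ 2 = ρ ^ 2 * v j ^ 2 := by simp only [r]; ring
  have hKr : K * v j ^ 2 < r ^ 2 := by
    rw [hr2]; exact mul_lt_mul_of_pos_right hK hj2
  have hcs : m ^ 2 ≤ N := by
    have := Finset.sum_mul_sq_le_sq_mul_sq Finset.univ (fun l => B l j) v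
    rwa [hv, mul_one] at this
  have hN0 : 0 < N := by
    refine (Finset.sum_nonneg fun l _ => sq_nonneg _).lt_of_ne fun h => ?_
    rw [← hN] at h
    have hm0 : m = 0 := by
      have : m ^ 2 ≤ 0 := h ▸ hcs
      exact pow_eq_zero_iff (two_ne_zero) |>.1 (le_antisymm this (sq_nonneg m))
    rw [← h, hm0] at hle
    linarith
  refine ⟨j, sum_sq_direction B j hN0, ?_⟩
  have hdir : (∑ l, direction B j l * v l) ^ 2 = m ^ 2 / N := by
    have : ∑ l, direction B j l * v l = m / Real.sqrt N := by
      rw [hm, Finset.sum_div]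
      exact Finset.sum_congr rfl fun l _ => by simp only [direction]; ring
    rw [this, div_pow, Real.sq_sqrt hN0.le]
  rw [hdir, le_div_iff₀ hN0]
  have hKρ : K / ρ ^ 2 * r ^ 2 = K * v j ^ 2 := by
    rw [hr2]; field_simp
  have hrpos : 0 < r ^ 2 := by rw [hr2]; positivity
  have hfin : r ^ 2 * ((1 - K / ρ ^ 2) * N) ≤ r ^ 2 * m ^ 2 := by
    have e : r ^ 2 * ((1 - K / ρ ^ 2) * N) = (r ^ 2 - K * v j ^ 2) * N := by
      rw [← hKρ]; ring
    rw [e]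
    -- `(r² - K v_j²)N ≤ 2rmN - N² ≤ r²m²`.
    nlinarith [sq_nonneg (r * m - N), mul_le_mul_of_nonneg_right hle hN0.le]
  exact le_of_mul_le_mul_left hfin hrpos

/-- For a unit vector `y` the best multiple of `yyᵀ` leaves squared error `‖B‖² - (yᵀBy)²`.
Maximizing `(yᵀBy)²` over columns therefore does at least as well as the good column of
`exists_direction`, and the triangle inequality passes from `B` to the spike. -/
theorem sqNorm_principalDirection_sub_le (hd : 0 < d) (hv : ∑ j, v j ^ 2 = 1) (hρ : 0 < ρ)
    {B : Fin d → Fin d → ℝ} {K : ℝ}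
    (hB : sqNorm (fun j l => B j l - ρ * (v j * v l)) ≤ K) :
    sqNorm (fun j l => principalDirection B j * principalDirection B l - 1 * (v j * v l)) ≤
      28 * (K / ρ ^ 2) := by
  obtain ⟨hu, hbest⟩ := principalDirection_spec hd B
  set u := principalDirection B
  have hρ2 : 0 < ρ ^ 2 := by positivity
  rw [sqNorm_outer_sub hu hv]
  set x := (∑ j, u j * v j) ^ 2
  have hx0 : 0 ≤ x := sq_nonneg _
  have hx1 : x ≤ 1 := inner_sq_le_one hu hv
  rcases le_or_gt (ρ ^ 2) K with hK | hK
  · have : 1 ≤ K / ρ ^ 2 := (one_le_div hρ2).2 hK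
    linarith
  · obtain ⟨j, hw, hwv⟩ := exists_direction hv hρ hK hB
    set w := direction B j
    have h1 : sqNorm (fun a b => v a * v b - 1 * (w a * w b)) ≤ 2 * (K / ρ ^ 2) := by
      rw [sqNorm_outer_sub hv hw, Finset.sum_congr rfl fun a _ => mul_comm (v a) (w a)]
      linarith
    have h2 : sqNorm (fun a b => B a b - ρ * (w a * w b)) ≤ 6 * K := by
      have e1 := sqNorm_sub_le B (fun a b => ρ * (v a * v b)) fun a b => ρ * (w a * w b)
      have e2 : sqNorm (fun a b => ρ * (v a * v b) - ρ * (w a * w b)) =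
          ρ ^ 2 * sqNorm (fun a b => v a * v b - 1 * (w a * w b)) := by
        simp only [sqNorm, Finset.mul_sum]
        exact Finset.sum_congr rfl fun a _ => Finset.sum_congr rfl fun b _ => by ring
      have e3 : ρ ^ 2 * sqNorm (fun a b => v a * v b - 1 * (w a * w b)) ≤ 2 * K := by
        refine (mul_le_mul_of_nonneg_left h1 hρ2.le).trans_eq ?_
        field_simp
      linarith
    have hform : ∀ (y : Fin d → ℝ) (r : ℝ), ∑ a, y a ^ 2 = 1 →
        sqNorm (fun a b => B a b - r * (y a * y b)) = sqNorm B - 2 * r * quadForm B y + r ^ 2 :=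
      fun y r hy => by
        rw [sqNorm_sub_mul, sqNorm_outer, hy, quadForm_eq_frobInner]
        ring
    set lam := quadForm B u
    have h3 : sqNorm (fun a b => B a b - lam * (u a * u b)) ≤ 6 * K := by
      rw [hform w ρ hw] at h2
      rw [hform u lam hu]
      have := hbest j
      nlinarith [sq_nonneg (quadForm B w - ρ)]
    have h4 : sqNorm (fun a b => lam * (u a * u b) - ρ * (v a * v b)) ≤ 14 * K := by
      have e1 := sqNorm_sub_le (fun a b => lam * (u a * u b)) B fun a b => ρ * (v a * v b)
      have e2 : sqNorm (fun a b => lam * (u a * u b) - B a b) =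
          sqNorm (fun a b => B a b - lam * (u a * u b)) := by
        simp only [sqNorm]
        exact Finset.sum_congr rfl fun a _ => Finset.sum_congr rfl fun b _ => by ring
      linarith
    have h5 : sqNorm (fun a b => lam * (u a * u b) - ρ * (v a * v b)) =
        lam ^ 2 - 2 * lam * ρ * x + ρ ^ 2 := by
      have e1 : frobInner (fun a b => lam * (u a * u b)) (fun a b => v a * v b) = lam * x := by
        have : x = frobInner (fun a b => u a * u b) fun a b => v a * v b := by
          rw [← quadForm_eq_frobInner, quadForm_outer]
        rw [this]
        simp only [frobInner, Finset.mul_sum, mul_assoc]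
      have e2 : sqNorm (fun a b => lam * (u a * u b)) = lam ^ 2 := by
        have : sqNorm (fun a b => lam * (u a * u b)) = lam ^ 2 * sqNorm fun a b => u a * u b := by
          simp only [sqNorm, mul_pow, Finset.mul_sum]
        rw [this, sqNorm_outer, hu]
        ring
      rw [sqNorm_sub_mul, e1, e2, sqNorm_outer, hv]
      ring
    rw [h5] at h4
    -- Minimize over the uncontrolled scale `lam`; the minimum is at `lam = ρx`.
    have h6 : ρ ^ 2 * (1 - x ^ 2) ≤ 14 * K := by nlinarith [sq_nonneg (lam - ρ * x)]
    have h7 : 1 - x ^ 2 ≤ 14 * (K / ρ ^ 2) := by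
      rw [← mul_div_assoc, le_div_iff₀ hρ2]
      linarith
    nlinarith

/-! ### Reordering of the samples -/

theorem IsStable.comp_perm (hG : IsStable k ε δ ρ v G) (σ : Equiv.Perm (Fin n)) :
    IsStable k ε δ ρ v fun i => G (σ i) := by
  intro w hw
  have h := hG (fun i => w (σ.symm i)) ⟨fun i => hw.1 _, by
    rw [Equiv.sum_comp σ.symm w]; exact hw.2⟩
  have e : secondMoment G (fun i => w (σ.symm i)) = secondMoment (fun i => G (σ i)) w := by
    simp only [secondMoment]
    rw [← Equiv.sum_comp σ]
    simp
  rwa [e] at h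

/-- The slack `α = 250δ` covers `4ε + 10δ` (as `ε ≤ 60δ`) and `14δ`. If `ρ < 250δ` the trivial bound
2 suffices; if `d = 1`, where `eps_le` is not available, all unit vectors give the same `uuᵀ`. -/
theorem sqNorm_estimate_le (hn : 0 < n) (hρ : 0 < ρ) (hρ1 : ρ ≤ 1) (hε0 : 0 < ε)
    (hε : ε ≤ 1 / 20) (hv : IsSparseUnit k v) (hG : IsStable k ε δ ρ v G)
    {E : Finset (Fin n)} (hE : (E.card : ℝ) ≤ ε * n) (hS : ∀ i, i ∉ E → S i = G i) :
    sqNorm (fun j l => principalDirection (robustMatrix k ε S) j *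
      principalDirection (robustMatrix k ε S) l - 1 * (v j * v l)) ≤ 1000 ^ 2 * (δ / ρ) := by
  have hδ := hG.nonneg hn hε0.le hε
  have hne : ∃ j, v j ≠ 0 := by
    by_contra h
    push Not at h
    have := hv.1
    simp [h] at this
  obtain ⟨j₀, hj₀⟩ := hne
  have hd : 0 < d := j₀.pos
  have hk : 0 < k := by
    refine lt_of_lt_of_le ?_ hv.2
    rw [Set.ncard_pos]
    exact ⟨j₀, hj₀⟩
  have hr : 0 ≤ δ / ρ := by positivity
  obtain ⟨hu, -⟩ := principalDirection_spec hd (robustMatrix k ε S)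
  by_cases hd2 : ∃ j l : Fin d, j ≠ l
  · obtain ⟨j, l, hjl⟩ := hd2
    have hεδ := hG.eps_le hk hn hε0.le hε hρ.le hjl
    rcases le_or_gt (250 * δ) ρ with hsmall | hlarge
    · obtain ⟨c, hc, hrob, hnorm⟩ := robustMatrix_spec hn hρ hε0 hε hv.1 hG hE hS
      have hquad := le_quadForm_centeredMoment hn hρ hρ1 hε0 hε hv hG hE hS hc
      rw [hrob] at hnorm ⊢
      have h1 := sqNorm_truncate_sub_le hv (α := 250 * δ) (by linarith) hsmall
        (hnorm.trans (pow_le_pow_left₀ (by linarith) (by linarith) 2)) (by linarith)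
      refine (sqNorm_principalDirection_sub_le hd hv.1 hρ h1).trans ?_
      have e : 26 * (ρ * (250 * δ)) / ρ ^ 2 = 6500 * (δ / ρ) := by
        field_simp
        ring
      rw [e]
      linarith
    · rw [sqNorm_outer_sub hu hv.1]
      have h1 : 1 / 250 ≤ δ / ρ := by
        rw [le_div_iff₀ hρ]
        linarith
      nlinarith [sq_nonneg (∑ j, principalDirection (robustMatrix k ε S) j * v j)]
  · push Not at hd2
    have hx : (∑ j, principalDirection (robustMatrix k ε S) j * v j) ^ 2 = 1 := by
      have huniv : (Finset.univ : Finset (Fin d)) = {j₀} := by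
        ext l
        simp [hd2 l j₀]
      have hv1 := hv.1
      rw [huniv, Finset.sum_singleton] at hu hv1 ⊢
      rw [mul_pow, hu, hv1, one_mul]
    rw [sqNorm_outer_sub hu hv.1, hx]
    nlinarith

end RobustSparsePCA

theorem mainTheorem4 :
    ∃ (ε₀ C : ℝ) (c : ℕ)
      (alg : RobustSparsePCA.Prog RobustSparsePCA.inputTy RobustSparsePCA.outputTy),
      0 < ε₀ ∧ ε₀ < 1 / 2 ∧
      -- polynomial running time, on every input
      (∀ (n d k : ℕ) (ε : ℝ) (S : Fin n → Fin d → ℝ),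
        alg.steps (RobustSparsePCA.encodeInput S k ε) ≤ c * (n + d + 1) ^ c) ∧
      -- the error guarantee
      (∀ (n d k : ℕ) (ρ ε δ : ℝ) (v : Fin d → ℝ) (G S : Fin n → Fin d → ℝ),
        0 < n → 0 < ρ → ρ ≤ 1 → 0 < ε → ε < ε₀ →
        RobustSparsePCA.IsSparseUnit k v →
        RobustSparsePCA.IsStable k ε δ ρ v G →
        RobustSparsePCA.IsCorruption ε G S →
        ∃ u : Fin d → ℝ,
          alg.run (RobustSparsePCA.encodeInput S k ε) = List.ofFn u ∧
          ‖Matrix.vecMulVec u u - Matrix.vecMulVec v v‖ ≤ C * Real.sqrt (δ / ρ)) := by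
  classical
  obtain ⟨c, alg, hsteps, hrun⟩ := RobustSparsePCA.exists_polyTime_estimator
  refine ⟨1 / 20, 1000, c, alg, by norm_num, by norm_num, hsteps,
    fun n d k ρ ε δ v G S hn hρ hρ1 hε0 hε hv hG ⟨σ, hσ⟩ => ⟨_, hrun n d k ε S hn, ?_⟩⟩
  have hδ := hG.nonneg hn hε0.le hε.le
  have hE : ((Finset.univ.filter fun i => S i ≠ G (σ i)).card : ℝ) ≤ ε * n := by
    rwa [Set.ncard_eq_toFinset_card', Set.toFinset_ofPred] at hσ
  have h := RobustSparsePCA.sqNorm_estimate_le hn hρ hρ1 hε0 hε.le hv (hG.comp_perm σ) hE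
    (S := S) fun i hi => by simpa using hi
  refine le_of_sq_le_sq ?_ (by positivity)
  rw [mul_pow, Real.sq_sqrt (by positivity), RobustSparsePCA.sq_norm_eq_sqNorm]
  refine le_trans (le_of_eq ?_) h
  congr 1
  funext j l
  simp [Matrix.vecMulVec_apply]
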